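/- Let $n,s,k$ be integers with $s\ge 2$, $k\ge 2$ and $n\ge sk+1$. Let $KG(n,k)_{s\text{-stab}}$ be the $s$-stable Kneser graph: its vertices are the $k$-element subsets $S$ of $\{1,\dots,n\}$ such that $s\le |i-j|\le n-s$ for all distinct $i,j\in S$, and two vertices are adjacent if and only if they are disjoint as sets. Then the automorphism group of $KG(n,k)_{s\text{-stab}}$ is isomorphic to the dihedral group $D_{2n}$ of order $2n$. -/

import Mathlib

/-- The Kneser graph `KG(n,k)`: its vertices are the `k`-subsets of an `n`-element set (labelled
cyclically by `0, …, n - 1`), and two distinct vertices are adjacent iff they are disjoint.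
(Distinctness is automatic from disjointness when `k` is positive.) -/
def kneserGraph (n k : ℕ) : SimpleGraph {S : Finset (Fin n) // S.card = k} where
  Adj S T := S ≠ T ∧ Disjoint S.1 T.1
  symm := ⟨fun _ _ h => ⟨h.1.symm, h.2.symm⟩⟩
  loopless := ⟨fun _ h => h.1 rfl⟩

/-- A set `S` of points of the `n`-cycle is `s`-stable if `s ≤ |i - j| ≤ n - s` for all distinct
`i, j ∈ S`. The differences are taken in the integers. -/
def IsStableSet {n : ℕ} (s : ℕ) (S : Finset (Fin n)) : Prop :=
  ∀ i ∈ S, ∀ j ∈ S, i ≠ j →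
    (s : ℤ) ≤ |((i : ℕ) : ℤ) - ((j : ℕ) : ℤ)| ∧
      |((i : ℕ) : ℤ) - ((j : ℕ) : ℤ)| ≤ (n : ℤ) - (s : ℤ)

/-- The `s`-stable Kneser graph: the subgraph of the Kneser graph `KG(n,k)` induced by the
`s`-stable `k`-subsets. -/
def stableKneserGraph (n k s : ℕ) :
    SimpleGraph ↥{S : {S : Finset (Fin n) // S.card = k} | IsStableSet s S.1} :=
  (kneserGraph n k).induce {S : {S : Finset (Fin n) // S.card = k} | IsStableSet s S.1}

/-! Label the points by `ZMod n`. Rotations and reflections act faithfully; it remains to see that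
every automorphism `φ` of the disjointness graph is one of them.

Set structure is recovered from adjacency through hulls: `R` is in the hull of `S`, `T` if every
configuration disjoint from both is disjoint from `R`. Each `R ⊆ S ∪ T` qualifies, and nothing else
does when `T` is `S` with one point exchanged (`exists_separated_avoiding`). With the exchange lemma
`exists_separated_swap` this describes one-point exchanges by disjointness alone (`oneSwap_iff`), so
`φ` preserves them, and also slides, the exchanges of points at distance less than `s`
(`near_iff_of_sdiff`).

If `n ≥ s k + 2`, 4-cycles and triangles of exchanges show that the point removed by the image of a
slide depends only on the point the slide removes. The resulting permutation `π` of the points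
induces `φ` (`exists_isPointMap`, `IsPointMap.map_eq`). It preserves the pairs exchanged by some
slide, namely those at distance at most `min (s - 1) (n - s k)` (`linked_iff`). Balls of that radius
reveal which points are consecutive, so `π` is a symmetry of the cycle.

If `n = s k + 1`, every configuration is a progression of difference `s` (`exists_eq_base`), and
exchanges link the progression from `a` exactly to those from `a ± s`. As `s` is invertible modulo
`n`, exchanges form an `n`-cycle, and `φ` is again dihedral. -/

open Finset

/-- `S` contains no two points whose cyclic distance is positive and less than `s`. -/
def Separated {n : ℕ} (s : ℕ) (S : Finset (ZMod n)) : Prop :=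
  ∀ i ∈ S, ∀ d : ℕ, 0 < d → d < s → i + (d : ZMod n) ∉ S

/-! ### Arithmetic modulo `n`. -/

section Arithmetic

variable {n : ℕ}

theorem natCast_zmod_ne_zero {d : ℕ} (h0 : 0 < d) (hd : d < n) : (d : ZMod n) ≠ 0 := by
  intro h
  rw [ZMod.natCast_eq_zero_iff] at h
  exact absurd (Nat.le_of_dvd h0 h) (by omega)

theorem intCast_zmod_eq_zero {d : ℤ} (h : (d : ZMod n) = 0) (h1 : -(n : ℤ) < d) (h2 : d < n) :
    d = 0 := by
  rw [ZMod.intCast_zmod_eq_zero_iff_dvd] at h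
  exact Int.eq_zero_of_abs_lt_dvd h (abs_lt.2 ⟨h1, h2⟩)

theorem exists_add_natCast [NeZero n] (a b : ZMod n) : ∃ d : ℕ, d < n ∧ b = a + d :=
  ⟨(b - a).val, ZMod.val_lt _, by simp⟩

end Arithmetic

/-! ### Separated sets: translates, avoidance and exchange. -/

section Separation

variable {n s : ℕ} {S T Z : Finset (ZMod n)}

theorem Separated.sub_notMem (h : Separated s S) {i : ZMod n} (hi : i ∈ S) {d : ℕ} (h0 : 0 < d)
    (hd : d < s) : i - (d : ZMod n) ∉ S := by
  intro h'
  have := h _ h' d h0 hd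
  simp [hi] at this

theorem Separated.mono (h : Separated s T) (hST : S ⊆ T) : Separated s S :=
  fun i hi d h0 hd hm => h i (hST hi) d h0 hd (hST hm)

theorem Separated.insert (h : Separated s S) {t : ZMod n}
    (hu : ∀ d : ℕ, 0 < d → d < s → t + (d : ZMod n) ∉ S)
    (hl : ∀ d : ℕ, 0 < d → d < s → t - (d : ZMod n) ∉ S) (hn : s ≤ n) :
    Separated s (insert t S) := by
  intro i hi d h0 hd hm
  rw [mem_insert] at hi hm
  have hne := natCast_zmod_ne_zero h0 (lt_of_lt_of_le hd hn)
  rcases hi with rfl | hi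
  · rcases hm with hm | hm
    · exact hne (by simpa using hm)
    · exact hu d h0 hd hm
  · rcases hm with hm | hm
    · exact hl d h0 hd (by rw [← hm]; simpa using hi)
    · exact h i hi d h0 hd hm

/-- Replacing `a` by `t` keeps a set separated if `a` is the only point too close to `t`. -/
theorem Separated.swap (h : Separated s S) {a t : ZMod n}
    (hu : ∀ d : ℕ, 0 < d → d < s → t + (d : ZMod n) ∈ S → t + (d : ZMod n) = a)
    (hl : ∀ d : ℕ, 0 < d → d < s → t - (d : ZMod n) ∈ S → t - (d : ZMod n) = a) (hn : s ≤ n) :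
    Separated s (Insert.insert t (S.erase a)) := by
  refine (h.mono (erase_subset _ _)).insert ?_ ?_ hn
  · intro d h0 hd hm
    exact (mem_erase.1 hm).1 (hu d h0 hd (mem_erase.1 hm).2)
  · intro d h0 hd hm
    exact (mem_erase.1 hm).1 (hl d h0 hd (mem_erase.1 hm).2)

theorem card_insert_erase' {α : Type*} [DecidableEq α] {S : Finset α} {a t : α} (ha : a ∈ S)
    (ht : t ∉ S) : (insert t (S.erase a)).card = S.card := by
  rw [card_insert_of_notMem (fun h => ht (mem_of_mem_erase h)), card_erase_add_one ha]

/-- The translate of `S` by `c`. -/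
def shift (c : ZMod n) (S : Finset (ZMod n)) : Finset (ZMod n) :=
  S.map (addRightEmbedding c)

@[simp] theorem mem_shift {c x : ZMod n} : x ∈ shift c S ↔ x - c ∈ S := by
  simp only [shift, mem_map, addRightEmbedding_apply]
  constructor
  · rintro ⟨y, hy, rfl⟩; simpa using hy
  · intro h; exact ⟨_, h, by ring⟩

@[simp] theorem card_shift (c : ZMod n) (S : Finset (ZMod n)) : (shift c S).card = S.card := by
  simp [shift]

theorem Separated.shift (h : Separated s S) (c : ZMod n) : Separated s (shift c S) := by
  intro i hi d h0 hd hm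
  rw [mem_shift] at hi hm
  exact h _ hi d h0 hd (by rwa [sub_add_eq_add_sub])

/-- Apart from `b` itself, only `b - s` could come too close to `b - 1`. -/
theorem Separated.shift_down (h : Separated s S) (hn : s ≤ n) {b : ZMod n}
    (hb : b ∈ S) (hb' : b - (s : ZMod n) ∉ S) :
    Separated s (Insert.insert (b - 1) (S.erase b)) := by
  apply h.swap _ _ hn
  · intro d h0 hd hm
    obtain ⟨d, rfl⟩ := Nat.exists_eq_add_of_lt h0
    rcases Nat.eq_zero_or_pos d with rfl | hd0
    · simp
    · refine absurd ?_ (h b hb d hd0 (by omega))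
      convert hm using 1
      push_cast; ring
  · intro d h0 hd hm
    have e : b - 1 - (d : ZMod n) = b - ((d + 1 : ℕ) : ZMod n) := by push_cast; ring
    rw [e] at hm
    rcases lt_or_eq_of_le (Nat.succ_le_of_lt hd) with h1 | h1
    · exact absurd hm (h.sub_notMem hb (by omega) h1)
    · rw [Nat.succ_eq_add_one] at h1
      rw [h1] at hm
      exact absurd hm hb'

/-- Any point outside the union of two separated sets which differ in a single point lies in a
separated set of the same size avoiding both. -/
theorem exists_separated_avoiding (hs : 2 ≤ s) (hn : 2 * s ≤ n) {a x y : ZMod n}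
    (ha : a ∉ Z) (hx : x ∉ Z) (hS : Separated s (insert a Z)) (hT : Separated s (insert x Z))
    (hax : ∀ d : ℕ, 0 < d → d < s → a ≠ x + d) (hya : y ≠ a) (hyx : y ≠ x) (hyZ : y ∉ Z) :
    ∃ Q : Finset (ZMod n), Q.card = Z.card + 1 ∧ Separated s Q ∧ y ∈ Q ∧
      Disjoint Q (insert a Z) ∧ Disjoint Q (insert x Z) := by
  have cS : (insert a Z).card = Z.card + 1 := card_insert_of_notMem ha
  have cT : (insert x Z).card = Z.card + 1 := card_insert_of_notMem hx
  have avoid : ∀ Q : Finset (ZMod n), a ∉ Q → x ∉ Q → (∀ z ∈ Z, z ∉ Q) →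
      Disjoint Q (insert a Z) ∧ Disjoint Q (insert x Z) := by
    intro Q h1 h2 h3
    constructor <;> rw [disjoint_right] <;> intro z hz <;> rcases mem_insert.1 hz with rfl | hz
    · exact h1
    · exact h3 _ hz
    · exact h2
    · exact h3 _ hz
  have haZ : ∀ i : ℕ, 0 < i → i < s → a + (i : ZMod n) ∉ Z ∧ a - (i : ZMod n) ∉ Z := fun i h0 h1 =>
    ⟨fun h => hS a (mem_insert_self _ _) i h0 h1 (mem_insert_of_mem h),
      fun h => hS.sub_notMem (mem_insert_self _ _) h0 h1 (mem_insert_of_mem h)⟩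
  have hxZ : ∀ i : ℕ, 0 < i → i < s → x + (i : ZMod n) ∉ Z ∧ x - (i : ZMod n) ∉ Z := fun i h0 h1 =>
    ⟨fun h => hT x (mem_insert_self _ _) i h0 h1 (mem_insert_of_mem h),
      fun h => hT.sub_notMem (mem_insert_self _ _) h0 h1 (mem_insert_of_mem h)⟩
  have hax' : ∀ d : ℕ, 0 < d → d < s → a - d ≠ x := by
    intro d h0 h1 h; exact hax d h0 h1 (by rw [← h]; ring)
  have hxa' : ∀ d : ℕ, 0 < d → d < s → x + d ≠ a := fun d h0 h1 h => hax d h0 h1 h.symm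
  -- Small upward translates of `T = Z ∪ {x}` and downward ones of `S = Z ∪ {a}` miss both sets; the
  -- only possible collision, `a = x + i`, is excluded by `hax`.
  have Tup : ∀ i : ℕ, 0 < i → i < s → a ∉ shift (i : ZMod n) (insert x Z) ∧
      x ∉ shift (i : ZMod n) (insert x Z) ∧ ∀ z ∈ Z, z ∉ shift (i : ZMod n) (insert x Z) := by
    intro i h0 h1
    refine ⟨?_, ?_, ?_⟩
    · rw [mem_shift, mem_insert, not_or]
      exact ⟨hax' i h0 h1, (haZ i h0 h1).2⟩
    · rw [mem_shift]
      exact hT.sub_notMem (mem_insert_self _ _) h0 h1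
    · intro z hz
      rw [mem_shift]
      exact hT.sub_notMem (mem_insert_of_mem hz) h0 h1
  have Sdown : ∀ i : ℕ, 0 < i → i < s → a ∉ shift (-(i : ZMod n)) (insert a Z) ∧
      x ∉ shift (-(i : ZMod n)) (insert a Z) ∧
      ∀ z ∈ Z, z ∉ shift (-(i : ZMod n)) (insert a Z) := by
    intro i h0 h1
    refine ⟨?_, ?_, ?_⟩
    · rw [mem_shift, sub_neg_eq_add]
      exact hS _ (mem_insert_self _ _) i h0 h1
    · rw [mem_shift, sub_neg_eq_add, mem_insert, not_or]
      exact ⟨hxa' i h0 h1, (hxZ i h0 h1).1⟩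
    · intro z hz
      rw [mem_shift, sub_neg_eq_add]
      exact hS _ (mem_insert_of_mem hz) i h0 h1
  by_cases c1 : ∃ i : ℕ, 0 < i ∧ i < s ∧ y - i ∈ insert x Z
  · obtain ⟨i, h0, h1, hi⟩ := c1
    obtain ⟨p, q, r⟩ := Tup i h0 h1
    exact ⟨_, by rw [card_shift, cT], hT.shift i, mem_shift.2 hi, avoid _ p q r⟩
  by_cases c2 : ∃ i : ℕ, 0 < i ∧ i < s ∧ y + i ∈ insert a Z
  · obtain ⟨i, h0, h1, hi⟩ := c2
    obtain ⟨p, q, r⟩ := Sdown i h0 h1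
    exact ⟨_, by rw [card_shift, cS], hS.shift _, mem_shift.2 (by simpa using hi), avoid _ p q r⟩
  -- `S` moved upwards could only meet `x`, which would force `y = x`. The next case is its mirror
  -- image.
  by_cases c3 : ∃ i : ℕ, 0 < i ∧ i < s ∧ y - i = a
  · obtain ⟨i, h0, h1, hi⟩ := c3
    refine ⟨shift i (insert a Z), by rw [card_shift, cS], hS.shift _,
      mem_shift.2 (by simp [hi]), avoid _ ?_ ?_ ?_⟩
    · rw [mem_shift]
      exact hS.sub_notMem (mem_insert_self _ _) h0 h1
    · rw [mem_shift, mem_insert, not_or]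
      refine ⟨fun h => hyx ?_, (hxZ i h0 h1).2⟩
      rw [← hi] at h
      exact (sub_left_injective h).symm
    · intro z hz
      rw [mem_shift]
      exact hS.sub_notMem (mem_insert_of_mem hz) h0 h1
  by_cases c4 : ∃ i : ℕ, 0 < i ∧ i < s ∧ y + i = x
  · obtain ⟨i, h0, h1, hi⟩ := c4
    refine ⟨shift (-(i : ZMod n)) (insert x Z), by rw [card_shift, cT], hT.shift _,
      mem_shift.2 (by simp [hi]), avoid _ ?_ ?_ ?_⟩
    · rw [mem_shift, sub_neg_eq_add, mem_insert, not_or]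
      refine ⟨fun h => hya ?_, (haZ i h0 h1).1⟩
      rw [← hi] at h
      exact (add_left_injective _ h).symm
    · rw [mem_shift, sub_neg_eq_add]
      exact hT _ (mem_insert_self _ _) i h0 h1
    · intro z hz
      rw [mem_shift, sub_neg_eq_add]
      exact hT _ (mem_insert_of_mem hz) i h0 h1
  -- Now `y` is at distance at least `s` from all of `S ∪ T`; one point of `T + 1` is traded for it.
  push Not at c1 c2 c3 c4
  set T := insert x Z with hTdef
  have hyT : y ∉ T := by simp [hTdef, hyx, hyZ]
  have yup : ∀ i : ℕ, 0 < i → i < s → y + i ∉ T := by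
    intro i h0 h1 h
    rcases mem_insert.1 h with h | h
    · exact c4 i h0 h1 h
    · exact c2 i h0 h1 (mem_insert_of_mem h)
  -- Only `y - s + 1` can lie in `T + 1` too close to `y`. If it does not, any point may be traded.
  obtain ⟨c, hc, hcy⟩ : ∃ c ∈ T, y - (s : ZMod n) ∈ T → y - (s : ZMod n) = c := by
    by_cases h : y - (s : ZMod n) ∈ T
    · exact ⟨_, h, fun _ => rfl⟩
    · exact ⟨x, mem_insert_self _ _, fun h' => absurd h' h⟩
  obtain ⟨p, q, r⟩ := Tup 1 one_pos (by omega)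
  rw [Nat.cast_one] at p q r
  have hc1 : c + 1 ∈ shift 1 T := by simpa using hc
  have hy1 : y ∉ shift 1 T := by
    rw [mem_shift]
    have := c1 1 one_pos (by omega)
    rwa [Nat.cast_one] at this
  refine ⟨insert y ((shift 1 T).erase (c + 1)), ?_, ?_, mem_insert_self _ _, avoid _ ?_ ?_ ?_⟩
  · rw [card_insert_erase' hc1 hy1, card_shift, cT]
  · refine (hT.shift 1).swap ?_ ?_ (by omega)
    · intro d h0 hd hm
      exfalso
      rw [mem_shift] at hm
      obtain ⟨d, rfl⟩ := Nat.exists_eq_add_of_lt h0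
      have e : y + ((0 + d + 1 : ℕ) : ZMod n) - 1 = y + d := by push_cast; ring
      rw [e] at hm
      rcases Nat.eq_zero_or_pos d with rfl | hd0
      · simp [hyT] at hm
      · exact yup d hd0 (by omega) hm
    · intro d h0 hd hm
      rw [mem_shift] at hm
      have e : y - (d : ZMod n) - 1 = y - ((d + 1 : ℕ) : ZMod n) := by push_cast; ring
      rw [e] at hm
      rcases lt_or_eq_of_le (Nat.succ_le_of_lt hd) with h1 | h1
      · exact absurd hm (c1 (d + 1) (by omega) h1)
      · rw [Nat.succ_eq_add_one] at h1
        rw [h1] at hm e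
        rw [← hcy hm, ← e]; ring
  · simp only [mem_insert, mem_erase, not_or, not_and]
    exact ⟨fun h => hya h.symm, fun _ => p⟩
  · simp only [mem_insert, mem_erase, not_or, not_and]
    exact ⟨fun h => hyx h.symm, fun _ => q⟩
  · intro z hz
    simp only [mem_insert, mem_erase, not_or, not_and]
    exact ⟨fun h => hyZ (h ▸ hz), fun _ => r z hz⟩

/-- Two intersecting separated sets of the same size can be brought closer by one exchange. -/
theorem exists_separated_swap [NeZero n] (hn : 2 * s ≤ n) (hS : Separated s S)
    (hT : Separated s T) (hc : S.card = T.card) (hne : S ≠ T) (hST : ¬ Disjoint S T) :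
    ∃ x ∈ T, x ∉ S ∧ ∃ a ∈ S, Separated s (insert x (S.erase a)) := by
  by_contra! hcon
  -- Points of `S` near `x` are outside `T`. If one side of `x` has none, the other has at most one,
  -- and exchanging it for `x` contradicts `hcon`.
  have key : ∀ x ∈ T \ S, (∃ i : ℕ, 0 < i ∧ i < s ∧ x + i ∈ S \ T) ∧
      ∃ i : ℕ, 0 < i ∧ i < s ∧ x - i ∈ S \ T := by
    intro x hx
    rw [mem_sdiff] at hx
    have up : ∀ i : ℕ, 0 < i → i < s → x + i ∉ T := hT x hx.1
    have dn : ∀ i : ℕ, 0 < i → i < s → x - i ∉ T := fun i => hT.sub_notMem hx.1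
    have hSne : S.Nonempty := by
      rw [not_disjoint_iff] at hST
      obtain ⟨p, hp, _⟩ := hST
      exact ⟨p, hp⟩
    constructor
    · by_contra! h
      have h' : ∀ i : ℕ, 0 < i → i < s → x + i ∉ S := fun i h0 h1 h2 =>
        h i h0 h1 (mem_sdiff.2 ⟨h2, up i h0 h1⟩)
      obtain ⟨a, ha, ha'⟩ : ∃ a ∈ S, ∀ d : ℕ, 0 < d → d < s → x - d ∈ S → x - d = a := by
        by_cases hd : ∃ d : ℕ, 0 < d ∧ d < s ∧ x - d ∈ S
        · obtain ⟨d, h0, h1, h2⟩ := hd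
          refine ⟨_, h2, fun e h3 h4 h5 => ?_⟩
          rcases lt_trichotomy d e with hlt | rfl | hlt
          · refine absurd h2 ?_
            have := hS _ h5 (e - d) (by omega) (by omega)
            rwa [Nat.cast_sub hlt.le, sub_add_sub_cancel] at this
          · rfl
          · refine absurd h5 ?_
            have := hS _ h2 (d - e) (by omega) (by omega)
            rwa [Nat.cast_sub hlt.le, sub_add_sub_cancel] at this
        · push Not at hd
          obtain ⟨a, ha⟩ := hSne
          exact ⟨a, ha, fun d h0 h1 h2 => absurd h2 (hd d h0 h1)⟩
      exact hcon x hx.1 hx.2 a ha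
        (hS.swap (fun d h0 h1 h2 => absurd h2 (h' d h0 h1)) ha' (by omega))
    · by_contra! h
      have h' : ∀ i : ℕ, 0 < i → i < s → x - i ∉ S := fun i h0 h1 h2 =>
        h i h0 h1 (mem_sdiff.2 ⟨h2, dn i h0 h1⟩)
      obtain ⟨a, ha, ha'⟩ : ∃ a ∈ S, ∀ d : ℕ, 0 < d → d < s → x + d ∈ S → x + d = a := by
        by_cases hd : ∃ d : ℕ, 0 < d ∧ d < s ∧ x + d ∈ S
        · obtain ⟨d, h0, h1, h2⟩ := hd
          refine ⟨_, h2, fun e h3 h4 h5 => ?_⟩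
          rcases lt_trichotomy d e with hlt | rfl | hlt
          · refine absurd h5 ?_
            have := hS _ h2 (e - d) (by omega) (by omega)
            rwa [Nat.cast_sub hlt.le, add_assoc, add_sub_cancel] at this
          · rfl
          · refine absurd h2 ?_
            have := hS _ h5 (d - e) (by omega) (by omega)
            rwa [Nat.cast_sub hlt.le, add_assoc, add_sub_cancel] at this
        · push Not at hd
          obtain ⟨a, ha⟩ := hSne
          exact ⟨a, ha, fun d h0 h1 h2 => absurd h2 (hd d h0 h1)⟩
      exact hcon x hx.1 hx.2 a ha
        (hS.swap ha' (fun d h0 h1 h2 => absurd h2 (h' d h0 h1)) (by omega))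
  choose! hup hdn using key
  choose! u u0 u1 u2 using hup
  choose! v v0 v1 v2 using hdn
  have hcard : (S \ T).card = (T \ S).card := card_sdiff_comm hc
  have hinj : Set.InjOn (fun x => x - (v x : ZMod n)) (T \ S : Finset (ZMod n)) := by
    intro x hx y hy hxy
    have hx' := mem_sdiff.1 (mem_coe.1 hx)
    have hy' := mem_sdiff.1 (mem_coe.1 hy)
    simp only at hxy
    rcases lt_trichotomy (v x) (v y) with h | h | h
    · refine absurd hy'.1 ?_
      have := hT x hx'.1 (v y - v x) (by omega) (by have := v1 y hy; omega)
      rw [Nat.cast_sub h.le] at this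
      have e : y = x + ((v y : ZMod n) - v x) := by linear_combination -hxy
      rwa [← e] at this
    · rw [h] at hxy
      exact sub_left_injective hxy
    · refine absurd hx'.1 ?_
      have := hT y hy'.1 (v x - v y) (by omega) (by have := v1 x hx; omega)
      rw [Nat.cast_sub h.le] at this
      have e : x = y + ((v x : ZMod n) - v y) := by linear_combination hxy
      rwa [← e] at this
  -- Equal cardinalities make the injection onto, so each `x + u x` is some `y - v y`.
  have hsurj := surj_on_of_inj_on_of_card_le (s := T \ S) (t := S \ T)
    (fun x _ => x - (v x : ZMod n)) (fun x hx => v2 x hx)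
    (fun x y hx hy h => hinj hx hy h) hcard.le
  obtain ⟨p, hpS, hpT⟩ := not_disjoint_iff.1 hST
  have hTS : (T \ S).Nonempty := by
    rw [nonempty_iff_ne_empty, Ne, sdiff_eq_empty_iff_subset]
    exact fun h => hne (eq_of_subset_of_card_le h hc.le).symm
  have far : ∀ {U : Finset (ZMod n)} {q : ZMod n}, Separated s U → q ∈ U → p ∈ U → q ≠ p →
      s ≤ (p - q).val := by
    intro U q hU hq hp hqp
    by_contra! hlt
    refine hU q hq (p - q).val ?_ hlt (by simpa using hp)
    rw [Nat.pos_iff_ne_zero, Ne, ZMod.val_eq_zero, sub_eq_zero]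
    exact fun h => hqp h.symm
  -- Let `x` be the last point of `T \ S` before the common point `p`. Then `y = x + u x + v y` is
  -- closer still; by `far`, neither step can jump past `p`.
  obtain ⟨x, hx, hmin⟩ := exists_min_image (T \ S) (fun x => (p - x).val) hTS
  have hxT := (mem_sdiff.1 hx).1
  have step : ∀ {q : ZMod n} {i : ℕ}, 0 < i → i < s → s ≤ (p - q).val →
      (p - (q + i)).val = (p - q).val - i := by
    intro q i h0 h1 h2
    have : p - (q + i) = (((p - q).val - i : ℕ) : ZMod n) := by
      rw [Nat.cast_sub (by omega)]
      simp; ring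
    rw [this, ZMod.val_cast_of_lt]
    have := ZMod.val_lt (p - q)
    omega
  have h1 := far hT hxT hpT (fun h => (mem_sdiff.1 hx).2 (h ▸ hpS))
  have hq := mem_sdiff.1 (u2 x hx)
  have h2 := far hS hq.1 hpS (fun h => hq.2 (h ▸ hpT))
  obtain ⟨y, hy, hyq⟩ := hsurj _ (u2 x hx)
  have h3 := hmin y hy
  have hyq' : y = x + (u x : ZMod n) + (v y : ZMod n) := by rw [hyq]; ring
  rw [hyq', step (v0 y hy) (v1 y hy) h2, step (u0 x hx) (u1 x hx) h1] at h3
  have := u0 x hx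
  have := u1 x hx
  omega

end Separation

/-! ### One-point exchanges of finite sets. -/

section OneSwap

variable {α : Type*} [DecidableEq α] {A B C D : Finset α} {a x : α}

/-- Exactly one point of `A` lies outside `B`. -/
def OneSwap (A B : Finset α) : Prop := (A \ B).card = 1

theorem OneSwap.symm (h : OneSwap A B) (hc : A.card = B.card) : OneSwap B A := by
  unfold OneSwap at *
  rw [← card_sdiff_comm hc, h]

theorem OneSwap.exists_eq (h : OneSwap A B) (hc : A.card = B.card) :
    ∃ a x, A \ B = {a} ∧ B \ A = {x} := by
  obtain ⟨a, ha⟩ := card_eq_one.1 h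
  obtain ⟨x, hx⟩ := card_eq_one.1 (h.symm hc)
  exact ⟨a, x, ha, hx⟩

theorem sdiff_insert_erase (ha : a ∈ A) (hx : x ∉ A) :
    A \ insert x (A.erase a) = {a} ∧ insert x (A.erase a) \ A = {x} := by
  constructor <;> ext t <;> simp only [mem_sdiff, mem_insert, mem_erase, mem_singleton] <;> grind

theorem oneSwap_insert_erase (ha : a ∈ A) (hx : x ∉ A) : OneSwap A (insert x (A.erase a)) := by
  rw [OneSwap, (sdiff_insert_erase ha hx).1, card_singleton]

theorem eq_insert_erase (ha : A \ B = {a}) (hx : B \ A = {x}) :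
    B = insert x (A.erase a) ∧ a ∈ A ∧ a ∉ B ∧ x ∈ B ∧ x ∉ A := by
  simp only [Finset.ext_iff, mem_sdiff, mem_singleton, mem_insert, mem_erase] at *
  grind

theorem OneSwap.not_disjoint (h : OneSwap A B) (h2 : 2 ≤ A.card) : ¬ Disjoint A B := by
  intro hd
  rw [OneSwap, sdiff_eq_self_of_disjoint hd] at h
  omega

/-- In an induced 4-cycle of the graph of exchanges, opposite edges exchange the same points. -/
theorem sdiff_eq_of_square (hAB : A.card = B.card) (hAC : A.card = C.card) (hAD : A.card = D.card)
    (h1 : OneSwap A B) (h2 : OneSwap B C) (h3 : OneSwap D C) (h4 : OneSwap A D)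
    (hac : A ≠ C) (hac' : ¬ OneSwap A C) (hbd : B ≠ D) (hbd' : ¬ OneSwap B D) :
    A \ B = D \ C ∧ B \ A = C \ D := by
  obtain ⟨a, x, e1, f1⟩ := h1.exists_eq hAB
  obtain ⟨b, y, e4, f4⟩ := h4.exists_eq hAD
  obtain ⟨c, z, e2, f2⟩ := h2.exists_eq (hAB.symm.trans hAC)
  obtain ⟨d, w, e3, f3⟩ := h3.exists_eq (hAD.symm.trans hAC)
  obtain ⟨rfl, a1, a2, a3, a4⟩ := eq_insert_erase e1 f1
  obtain ⟨rfl, b1, b2, b3, b4⟩ := eq_insert_erase e4 f4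
  have hab : a ≠ b := by
    rintro rfl
    by_cases hxy : x = y
    · subst hxy; exact hbd rfl
    · apply hbd'
      rw [OneSwap, card_eq_one]
      refine ⟨x, ?_⟩
      ext t; simp only [mem_sdiff, mem_insert, mem_erase, mem_singleton]; grind
  have hxy : x ≠ y := by
    rintro rfl
    apply hbd'
    rw [OneSwap, card_eq_one]
    refine ⟨b, ?_⟩
    ext t; simp only [mem_sdiff, mem_insert, mem_erase, mem_singleton]; grind
  -- `A` has at least two points outside `C`. Each of the two paths from `A` to `C` removes at most
  -- two, so these are `a` and `b`, and `C` is `A` with `a`, `b` replaced by `x`, `y`.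
  have nAC : ∀ u, A \ C = {u} → False := fun u h => hac' (by rw [OneSwap, h, card_singleton])
  have nAC' : ∀ u, u ∈ A → u ∉ C → ∃ v ∈ A, v ∉ C ∧ v ≠ u := by
    intro u hu hu'
    by_contra! h
    refine nAC u ?_
    ext t
    simp only [mem_sdiff, mem_singleton]
    exact ⟨fun ht => h t ht.1 ht.2, fun ht => ht ▸ ⟨hu, hu'⟩⟩
  have nAC2 : ∃ u ∈ A, u ∉ C := by
    by_contra! h
    exact hac (eq_of_subset_of_card_le h hAC.symm.le)
  obtain ⟨u, hu, hu'⟩ := nAC2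
  obtain ⟨v, hv, hv', hvu⟩ := nAC' u hu hu'
  simp only [Finset.ext_iff, mem_sdiff, mem_singleton, mem_insert, mem_erase] at *
  have ha : a ∉ C := by grind
  have hb : b ∉ C := by grind
  constructor
  · intro t
    grind
  · intro t
    grind

/-- Two exchanges whose results are again exchange-related and which bring in different points
remove the same point. -/
theorem sdiff_eq_of_triangle (hAB : A.card = B.card) (hAC : A.card = C.card)
    (h1 : OneSwap A B) (h2 : OneSwap A C) (h3 : OneSwap B C) (h : ¬ C ⊆ A ∪ B) :
    A \ B = A \ C := by
  obtain ⟨a, x, e1, f1⟩ := h1.exists_eq hAB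
  obtain ⟨b, y, e4, f4⟩ := h2.exists_eq hAC
  obtain ⟨c, z, e2, f2⟩ := h3.exists_eq (hAB.symm.trans hAC)
  obtain ⟨rfl, a1, a2, a3, a4⟩ := eq_insert_erase e1 f1
  obtain ⟨rfl, b1, b2, b3, b4⟩ := eq_insert_erase e4 f4
  -- Three sets pairwise one exchange apart either share all but one point or have a union with just
  -- one extra point; `h` excludes the latter.
  rw [subset_iff] at h
  simp only [Finset.ext_iff, mem_sdiff, mem_singleton, mem_insert, mem_erase, mem_union] at *
  grind

end OneSwap

/-- The `s`-separated `k`-subsets of `ZMod n`. -/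
def Config (n k s : ℕ) : Type := {S : Finset (ZMod n) // S.card = k ∧ Separated s S}

/-- The disjointness graph on the `s`-separated `k`-subsets of `ZMod n`. -/
def separatedGraph (n k s : ℕ) : SimpleGraph (Config n k s) where
  Adj S T := S ≠ T ∧ Disjoint S.1 T.1
  symm := ⟨fun _ _ h => ⟨h.1.symm, h.2.symm⟩⟩
  loopless := ⟨fun _ h => h.1 rfl⟩

/-! ### Recognizing exchanges from disjointness. -/

namespace Config

variable {n k s : ℕ}

theorem card_eq (S T : Config n k s) : S.1.card = T.1.card := S.2.1.trans T.2.1.symm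

/-- Every configuration disjoint from `S` and `T` is disjoint from `R`. -/
def InHull (S T R : Config n k s) : Prop :=
  ∀ Q : Config n k s, Disjoint Q.1 S.1 → Disjoint Q.1 T.1 → Disjoint Q.1 R.1

theorem InHull.of_subset {S T R : Config n k s} (h : R.1 ⊆ S.1 ∪ T.1) : InHull S T R :=
  fun _ h1 h2 => (disjoint_union_right.2 ⟨h1, h2⟩).mono_right h

theorem inHull_iff_of_oneSwap (hs : 2 ≤ s) (hn : 2 * s ≤ n) {S T R : Config n k s}
    (h : OneSwap S.1 T.1) : InHull S T R ↔ R.1 ⊆ S.1 ∪ T.1 := by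
  refine ⟨fun hR => ?_, InHull.of_subset⟩
  obtain ⟨a, x, e, f⟩ := h.exists_eq (card_eq S T)
  obtain ⟨hTe, ha, haT, hxT, hxS⟩ := eq_insert_erase e f
  set Z := S.1.erase a with hZ
  have hSe : S.1 = insert a Z := (insert_erase ha).symm
  have haZ : a ∉ Z := notMem_erase _ _
  have hxZ : x ∉ Z := fun h => hxS (mem_of_mem_erase h)
  have hSs := S.2.2
  have hTs := T.2.2
  rw [hSe] at hSs
  rw [hTe] at hTs
  intro y hy
  by_contra hyU
  simp only [hSe, hTe, mem_union, mem_insert, not_or] at hyU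
  obtain ⟨⟨h1, h2⟩, h3, -⟩ := hyU
  have hk : Z.card + 1 = k := by rw [hZ, card_erase_add_one ha, S.2.1]
  have main : ∃ Q : Finset (ZMod n), Q.card = Z.card + 1 ∧ Separated s Q ∧ y ∈ Q ∧
      Disjoint Q (insert a Z) ∧ Disjoint Q (insert x Z) := by
    -- As `2 * s ≤ n`, `a` cannot be just above `x` and `x` just above `a` simultaneously; the roles
    -- are exchanged if needed.
    by_cases hax : ∀ d : ℕ, 0 < d → d < s → a ≠ x + d
    · exact exists_separated_avoiding hs hn haZ hxZ hSs hTs hax h1 h3 h2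
    · push Not at hax
      obtain ⟨d, h0, hd, hax⟩ := hax
      obtain ⟨Q, q1, q2, q3, q4, q5⟩ := exists_separated_avoiding hs hn hxZ haZ hTs hSs (by
        intro d' h0' hd' hxa
        rw [hax, add_assoc, left_eq_add, ← Nat.cast_add] at hxa
        exact natCast_zmod_ne_zero (by omega) (by omega) hxa) h3 h1 h2
      exact ⟨Q, q1, q2, q3, q5, q4⟩
  obtain ⟨Q, q1, q2, q3, q4, q5⟩ := main
  have := hR ⟨Q, q1.trans hk, q2⟩ (by rw [hSe]; exact q4) (by rw [hTe]; exact q5)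
  exact disjoint_left.1 this q3 hy

/-- If `T` brings in only `x`, any `R ≠ S` inside `S ∪ T` contains `x`, whence `T ⊆ S ∪ R`.
Conversely, let `R` be `S` with one point exchanged for some `x ∈ T`; then `T ⊆ S ∪ R` leaves `x` as
the only point of `T \ S`. -/
theorem oneSwap_iff [NeZero n] (hs : 2 ≤ s) (hk : 2 ≤ k) (hn : 2 * s ≤ n) {S T : Config n k s} :
    OneSwap S.1 T.1 ↔ S ≠ T ∧ ¬ Disjoint S.1 T.1 ∧
      ∀ R, InHull S T R → R ≠ S → ¬ Disjoint S.1 R.1 → InHull S R T := by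
  constructor
  · intro h
    refine ⟨?_, h.not_disjoint (by rw [S.2.1]; exact hk), fun R hR hRS _ => ?_⟩
    · rintro rfl
      simp [OneSwap] at h
    · rw [inHull_iff_of_oneSwap hs hn h] at hR
      apply InHull.of_subset
      obtain ⟨a, x, e, f⟩ := h.exists_eq (card_eq S T)
      obtain ⟨hTe, ha, haT, hxT, hxS⟩ := eq_insert_erase e f
      have hxR : x ∈ R.1 := by
        by_contra hx
        refine hRS (Subtype.ext (eq_of_subset_of_card_le ?_ (card_eq S R).le))
        intro t ht
        have := hR ht
        rw [hTe] at this
        simp only [mem_union, mem_insert, mem_erase] at this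
        rcases this with h | rfl | h
        · exact h
        · exact absurd ht hx
        · exact h.2
      intro t ht
      rw [hTe, mem_insert, mem_erase] at ht
      rw [mem_union]
      rcases ht with rfl | ht
      · exact Or.inr hxR
      · exact Or.inl ht.2
  · rintro ⟨hne, hd, h⟩
    obtain ⟨x, hxT, hxS, a, haS, hR⟩ := exists_separated_swap hn S.2.2 T.2.2 (card_eq S T)
      (fun h => hne (Subtype.ext h)) hd
    set R : Config n k s := ⟨insert x (S.1.erase a), by rw [card_insert_erase' haS hxS, S.2.1], hR⟩
      with hRdef
    have hSR : OneSwap S.1 R.1 := oneSwap_insert_erase haS hxS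
    have h1 : InHull S T R := by
      apply InHull.of_subset
      intro t ht
      rw [mem_union]
      rcases mem_insert.1 ht with rfl | ht
      · exact Or.inr hxT
      · exact Or.inl (mem_of_mem_erase ht)
    have h2 := h R h1 (by
      intro h
      exact hxS (h ▸ mem_insert_self x _)) (hSR.not_disjoint (by rw [S.2.1]; exact hk))
    rw [inHull_iff_of_oneSwap hs hn hSR] at h2
    have : T.1 \ S.1 ⊆ {x} := by
      intro t ht
      rw [mem_sdiff] at ht
      have := h2 ht.1
      simp only [hRdef, mem_union, mem_insert, mem_erase] at this
      rw [mem_singleton]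
      tauto
    have hTS : OneSwap T.1 S.1 := by
      rw [OneSwap, subset_antisymm this (by simp [hxT, hxS]), card_singleton]
    exact hTS.symm (card_eq T S)

/-! ### Invariance of exchanges under automorphisms. -/

section Automorphism

variable (φ : separatedGraph n k s ≃g separatedGraph n k s)

theorem disjoint_iff (hk : 2 ≤ k) {S T : Config n k s} :
    Disjoint S.1 T.1 ↔ (separatedGraph n k s).Adj S T := by
  refine ⟨fun h => ⟨?_, h⟩, fun h => h.2⟩
  rintro rfl
  rw [disjoint_self, bot_eq_empty] at h
  have := S.2.1
  rw [h, card_empty] at this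
  omega

theorem disjoint_map (hk : 2 ≤ k) {S T : Config n k s} :
    Disjoint (φ S).1 (φ T).1 ↔ Disjoint S.1 T.1 := by
  rw [disjoint_iff hk, disjoint_iff hk, φ.map_adj_iff]

theorem inHull_map (hk : 2 ≤ k) {S T R : Config n k s} :
    InHull (φ S) (φ T) (φ R) ↔ InHull S T R := by
  constructor
  · intro h Q h1 h2
    rw [← disjoint_map φ hk] at *
    exact h _ h1 h2
  · intro h Q h1 h2
    obtain ⟨Q, rfl⟩ := φ.surjective Q
    rw [disjoint_map φ hk] at *
    exact h _ h1 h2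

theorem oneSwap_map [NeZero n] (hs : 2 ≤ s) (hk : 2 ≤ k) (hn : 2 * s ≤ n) {S T : Config n k s} :
    OneSwap (φ S).1 (φ T).1 ↔ OneSwap S.1 T.1 := by
  rw [oneSwap_iff hs hk hn, oneSwap_iff hs hk hn, disjoint_map φ hk, φ.injective.ne_iff,
    ← φ.toEquiv.forall_congr_right]
  simp [inHull_map φ hk, disjoint_map φ hk]

theorem map_subset_iff [NeZero n] (hs : 2 ≤ s) (hk : 2 ≤ k) (hn : 2 * s ≤ n)
    {S T R : Config n k s} (h : OneSwap S.1 T.1) :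
    (φ R).1 ⊆ (φ S).1 ∪ (φ T).1 ↔ R.1 ⊆ S.1 ∪ T.1 := by
  rw [← inHull_iff_of_oneSwap hs hn h,
    ← inHull_iff_of_oneSwap hs hn ((oneSwap_map φ hs hk hn).2 h), inHull_map φ hk]

theorem map_sdiff_of_square [NeZero n] (hs : 2 ≤ s) (hk : 2 ≤ k) (hn : 2 * s ≤ n)
    {A B C D : Config n k s} (h1 : OneSwap A.1 B.1) (h2 : OneSwap B.1 C.1) (h3 : OneSwap D.1 C.1)
    (h4 : OneSwap A.1 D.1) (hac : A ≠ C) (hac' : ¬ OneSwap A.1 C.1) (hbd : B ≠ D)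
    (hbd' : ¬ OneSwap B.1 D.1) :
    (φ A).1 \ (φ B).1 = (φ D).1 \ (φ C).1 ∧ (φ B).1 \ (φ A).1 = (φ C).1 \ (φ D).1 := by
  have inj : ∀ {P Q : Config n k s}, P ≠ Q → (φ P).1 ≠ (φ Q).1 := fun h h' =>
    h (φ.injective (Subtype.ext h'))
  rw [← oneSwap_map φ hs hk hn] at h1 h2 h3 h4 hac' hbd'
  exact sdiff_eq_of_square (card_eq _ _) (card_eq _ _) (card_eq _ _) h1 h2 h3 h4 (inj hac) hac'
    (inj hbd) hbd'

theorem map_sdiff_of_triangle [NeZero n] (hs : 2 ≤ s) (hk : 2 ≤ k) (hn : 2 * s ≤ n)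
    {A B C : Config n k s} (h1 : OneSwap A.1 B.1) (h2 : OneSwap A.1 C.1) (h3 : OneSwap B.1 C.1)
    (h : ¬ C.1 ⊆ A.1 ∪ B.1) : (φ A).1 \ (φ B).1 = (φ A).1 \ (φ C).1 := by
  rw [← map_subset_iff φ hs hk hn h1] at h
  rw [← oneSwap_map φ hs hk hn] at h1 h2 h3
  exact sdiff_eq_of_triangle (card_eq _ _) (card_eq _ _) h1 h2 h3 h

end Automorphism

end Config

/-! ### Progressions and induction on separated sets. -/

section Progression

variable {n k s : ℕ} {a b : ZMod n} {S : Finset (ZMod n)}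

theorem natCast_zmod_inj {i j : ℕ} (hi : i < n) (hj : j < n) (h : (i : ZMod n) = j) : i = j := by
  rw [ZMod.natCast_eq_natCast_iff'] at h
  rwa [Nat.mod_eq_of_lt hi, Nat.mod_eq_of_lt hj] at h

/-- The arithmetic progression `a, a + s, …, a + (k - 1) s`. -/
def progression (k s : ℕ) (a : ZMod n) : Finset (ZMod n) :=
  (range k).image fun j => a + ((s * j : ℕ) : ZMod n)

theorem mem_progression : b ∈ progression k s a ↔ ∃ j < k, b = a + ((s * j : ℕ) : ZMod n) := by
  simp only [progression, mem_image, mem_range, eq_comm]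

theorem self_mem_progression (hk : 0 < k) : a ∈ progression k s a :=
  mem_progression.2 ⟨0, hk, by simp⟩

theorem stride_mul_lt (hn : s * k < n) {j : ℕ} (hj : j ≤ k) : s * j < n :=
  lt_of_le_of_lt (Nat.mul_le_mul_left s hj) hn

theorem card_progression (hs : 0 < s) (hn : s * k < n) : (progression k s a).card = k := by
  rw [progression, card_image_of_injOn, card_range]
  intro i hi j hj h
  have := natCast_zmod_inj (stride_mul_lt hn (mem_range.1 hi).le)
    (stride_mul_lt hn (mem_range.1 hj).le) (add_right_injective a h)
  exact Nat.eq_of_mul_eq_mul_left hs this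

/-- A point `a + c` written with `c` in a range of length less than `n` lies in the progression
only for the obvious reason. -/
theorem add_intCast_mem_progression {c : ℤ} (h : a + (c : ZMod n) ∈ progression k s a)
    (h1 : (s : ℤ) * (k - 1) - n < c) (h2 : c < n) : ∃ j : ℕ, j < k ∧ c = s * j := by
  obtain ⟨j, hj, h⟩ := mem_progression.1 h
  refine ⟨j, hj, ?_⟩
  have h0 : ((c - s * j : ℤ) : ZMod n) = 0 := by
    have := add_right_injective a h
    push_cast at this ⊢
    rw [this, sub_self]
  have hj' : (s : ℤ) * j ≤ s * (k - 1) := mul_le_mul_of_nonneg_left (by omega) (by positivity)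
  have hj0 : (0 : ℤ) ≤ s * j := by positivity
  have := intCast_zmod_eq_zero h0 (by linarith) (by linarith)
  linarith

theorem separated_progression (hn : s * k < n) : Separated s (progression k s a) := by
  intro i hi d h0 hd hm
  obtain ⟨j, hj, rfl⟩ := mem_progression.1 hi
  have hj' : (s : ℤ) * (j + 1) ≤ s * k := mul_le_mul_of_nonneg_left (by omega) (by positivity)
  have hj0 : (0 : ℤ) ≤ s * j := by positivity
  have hn' : (s : ℤ) * k < n := by exact_mod_cast hn
  obtain ⟨j', -, h⟩ := add_intCast_mem_progression (k := k) (s := s) (a := a) (c := s * j + d)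
    (by push_cast at hm ⊢; rwa [← add_assoc]) (by linarith) (by linarith)
  have : (s : ℤ) ∣ d := ⟨j' - j, by linarith⟩
  have := Int.le_of_dvd (by omega) this
  omega

theorem sub_notMem_progression (hs : 0 < s) (hn : s * k < n) :
    a - (s : ZMod n) ∉ progression k s a := by
  intro hm
  have hn' : (s : ℤ) * k < n := by exact_mod_cast hn
  obtain ⟨j, -, h⟩ := add_intCast_mem_progression (k := k) (s := s) (a := a) (c := -s)
    (by push_cast at hm ⊢; rwa [← sub_eq_add_neg]) (by linarith) (by omega)
  have : (0 : ℤ) ≤ s * j := by positivity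
  omega

/-- A separated set in which every point except `a` is preceded by a point at distance `s` is a
progression. -/
theorem eq_progression [NeZero n] (hs : 0 < s) (hn : s * k < n) (hS : S.card = k)
    (hS' : Separated s S) (ha : a ∈ S) (h : ∀ b ∈ S, b ≠ a → b - (s : ZMod n) ∈ S) :
    S = progression k s a := by
  -- Walking back from `a + v` in steps of `s` cannot overshoot `a`, since a point at positive
  -- distance below `s` from `a` is forbidden.
  have key : ∀ v : ℕ, v < n → a + (v : ZMod n) ∈ S →
      ∃ j, v = s * j ∧ ∀ i ≤ j, a + ((s * i : ℕ) : ZMod n) ∈ S := by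
    intro v
    induction v using Nat.strong_induction_on with
    | _ v ih =>
      intro hv hvS
      rcases Nat.eq_zero_or_pos v with rfl | h0
      · exact ⟨0, by simp, fun i hi => by simpa [Nat.le_zero.1 hi] using ha⟩
      · have hsv : s ≤ v := by
          by_contra! hlt
          exact hS' a ha v h0 hlt hvS
        have h1 := h _ hvS (by simpa using natCast_zmod_ne_zero h0 hv)
        rw [add_sub_assoc, ← Nat.cast_sub hsv] at h1
        obtain ⟨j, hj, hj'⟩ := ih (v - s) (by omega) (by omega) h1
        refine ⟨j + 1, by rw [mul_add]; omega, fun i hi => ?_⟩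
        rcases lt_or_eq_of_le hi with hi | rfl
        · exact hj' i (by omega)
        · rwa [mul_add, ← hj, mul_one, Nat.sub_add_cancel hsv]
  refine eq_of_subset_of_card_le ?_ (by rw [hS, card_progression hs hn])
  intro b hb
  obtain ⟨v, hv, rfl⟩ := exists_add_natCast a b
  obtain ⟨j, rfl, hj⟩ := key v hv hb
  refine mem_progression.2 ⟨j, ?_, rfl⟩
  by_contra! hkj
  have hsub : progression (k + 1) s a ⊆ S := by
    intro t ht
    obtain ⟨i, hi, rfl⟩ := mem_progression.1 ht
    exact hj i (by omega)
  have := card_le_card hsub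
  have hc : (progression (k + 1) s a).card = k + 1 := by
    rw [progression, card_image_of_injOn, card_range]
    intro i hi i' hi' h
    have hi := mem_range.1 hi
    have hi' := mem_range.1 hi'
    exact Nat.eq_of_mul_eq_mul_left hs (natCast_zmod_inj (stride_mul_lt hn (by omega))
      (stride_mul_lt hn (by omega)) (add_right_injective a h))
  omega

/-- Every separated set containing `a` is obtained from the progression starting at `a` by
moving points other than `a` forward one step at a time. -/
theorem separated_induction [NeZero n] (hs : 2 ≤ s) (hn : s * k < n) (hsn : s ≤ n) (a : ZMod n)
    {P : Finset (ZMod n) → Prop} (base : P (progression k s a))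
    (step : ∀ S : Finset (ZMod n), S.card = k → Separated s S → a ∈ S → ∀ b ∈ S, b ≠ a →
      b - 1 ∉ S → Separated s (insert (b - 1) (S.erase b)) →
      P (insert (b - 1) (S.erase b)) → P S)
    (S : Finset (ZMod n)) (hS : S.card = k) (hS' : Separated s S) (ha : a ∈ S) : P S := by
  -- The total forward distance from `a` drops whenever a point steps back.
  induction hm : ∑ b ∈ S, (b - a).val using Nat.strong_induction_on generalizing S with
  | _ m ih =>
    by_cases h : ∀ b ∈ S, b ≠ a → b - (s : ZMod n) ∈ S
    · rw [eq_progression (by omega) hn hS hS' ha h]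
      exact base
    · push Not at h
      obtain ⟨b, hb, hba, hbs⟩ := h
      have hb1 : b - 1 ∉ S := by
        have := hS'.sub_notMem hb one_pos (by omega)
        rwa [Nat.cast_one] at this
      have hsep := hS'.shift_down hsn hb hbs
      refine step S hS hS' ha b hb hba hb1 hsep (ih _ ?_ _ ?_ hsep ?_ rfl)
      · rw [← hm, sum_insert (fun h => hb1 (mem_of_mem_erase h)), ← add_sum_erase _ _ hb]
        apply Nat.add_lt_add_right
        have h0 : 0 < (b - a).val := by
          rw [Nat.pos_iff_ne_zero, Ne, ZMod.val_eq_zero, sub_eq_zero]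
          exact hba
        have : b - 1 - a = (((b - a).val - 1 : ℕ) : ZMod n) := by
          rw [Nat.cast_sub h0]
          simp; ring
        rw [this, ZMod.val_cast_of_lt]
        · omega
        · have := ZMod.val_lt (b - a)
          omega
      · rw [card_insert_erase' hb hb1, hS]
      · exact mem_insert_of_mem (mem_erase.2 ⟨hba.symm, ha⟩)

end Progression

/-! ### Single steps and near points. -/

section Exchange

variable {n k s : ℕ}

theorem Separated.shift_up {S : Finset (ZMod n)} (h : Separated s S) (hn : s ≤ n) {b : ZMod n}
    (hb : b ∈ S) (hb' : b + (s : ZMod n) ∉ S) :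
    Separated s (Insert.insert (b + 1) (S.erase b)) := by
  apply h.swap _ _ hn
  · intro d h0 hd hm
    have e : b + 1 + (d : ZMod n) = b + ((d + 1 : ℕ) : ZMod n) := by push_cast; ring
    rw [e] at hm
    rcases lt_or_eq_of_le (Nat.succ_le_of_lt hd) with h1 | h1
    · exact absurd hm (h b hb _ (by omega) h1)
    · rw [Nat.succ_eq_add_one] at h1
      rw [h1] at hm
      exact absurd hm hb'
  · intro d h0 hd hm
    obtain ⟨d, rfl⟩ := Nat.exists_eq_add_of_lt h0
    rcases Nat.eq_zero_or_pos d with rfl | hd0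
    · simp
    · refine absurd ?_ (h.sub_notMem hb hd0 (by omega))
      convert hm using 1
      push_cast; ring

theorem not_oneSwap_of_ne {α : Type*} [DecidableEq α] {A B : Finset α} {u v : α} (huv : u ≠ v)
    (hu : u ∈ A) (hu' : u ∉ B) (hv : v ∈ A) (hv' : v ∉ B) : ¬ OneSwap A B := by
  intro h
  obtain ⟨a, ha⟩ := card_eq_one.1 h
  have h1 : u ∈ A \ B := mem_sdiff.2 ⟨hu, hu'⟩
  have h2 : v ∈ A \ B := mem_sdiff.2 ⟨hv, hv'⟩
  rw [ha, mem_singleton] at h1 h2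
  exact huv (h1.trans h2.symm)

/-- The cyclic distance of `a` and `x` is positive and at most `m`. -/
def Near (m : ℕ) (a x : ZMod n) : Prop :=
  ∃ d : ℕ, 0 < d ∧ d ≤ m ∧ (x = a + d ∨ a = x + d)

theorem Near.symm {m : ℕ} {a x : ZMod n} (h : Near m a x) : Near m x a := by
  obtain ⟨d, h0, h1, h2⟩ := h
  exact ⟨d, h0, h1, h2.symm⟩

theorem near_sub_natCast {m d : ℕ} {a : ZMod n} (h0 : 0 < d) (hd : d ≤ m) :
    Near m a (a - (d : ZMod n)) := ⟨d, h0, hd, Or.inr (by ring)⟩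

end Exchange

/-! ### Slides. -/

namespace Config

variable {n k s : ℕ}

/-- `T` arises from `S` by replacing `a` by a point `x` at distance less than `s` from `a`. -/
def Slide (S T : Config n k s) (a x : ZMod n) : Prop :=
  S.1 \ T.1 = {a} ∧ T.1 \ S.1 = {x} ∧ Near (s - 1) a x

theorem Slide.symm {S T : Config n k s} {a x : ZMod n} (h : Slide S T a x) : Slide T S x a :=
  ⟨h.2.1, h.1, h.2.2.symm⟩

theorem Slide.oneSwap {S T : Config n k s} {a x : ZMod n} (h : Slide S T a x) :
    OneSwap S.1 T.1 := by
  rw [OneSwap, h.1, card_singleton]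

theorem slide_of_eq {S T : Config n k s} {a x : ZMod n} (ha : a ∈ S.1) (hx : x ∉ S.1)
    (h : T.1 = insert x (S.1.erase a)) (hax : Near (s - 1) a x) : Slide S T a x := by
  refine ⟨?_, ?_, hax⟩ <;> rw [h]
  · exact (sdiff_insert_erase ha hx).1
  · exact (sdiff_insert_erase ha hx).2

/-- Slides are the exchanges whose two ends are the only configurations in their union. -/
theorem near_iff_of_sdiff (hk : 2 ≤ k) (hn : s ≤ n) {S T : Config n k s} {a x : ZMod n}
    (ha : S.1 \ T.1 = {a}) (hx : T.1 \ S.1 = {x}) :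
    Near (s - 1) a x ↔ ∀ R : Config n k s, R.1 ⊆ S.1 ∪ T.1 → R = S ∨ R = T := by
  obtain ⟨hT, haS, haT, hxT, hxS⟩ := eq_insert_erase ha hx
  constructor
  · rintro ⟨d, h0, hd, h⟩ R hR
    by_cases haR : a ∈ R.1
    · have hxR : x ∉ R.1 := by
        intro hxR
        rcases h with rfl | rfl
        · exact R.2.2 _ haR d h0 (by omega) hxR
        · exact R.2.2 _ hxR d h0 (by omega) haR
      refine Or.inl (Subtype.ext (eq_of_subset_of_card_le ?_ (card_eq S R).le))
      intro t ht
      have := hR ht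
      rw [hT] at this
      simp only [mem_union, mem_insert, mem_erase] at this
      rcases this with h | rfl | h
      · exact h
      · exact absurd ht hxR
      · exact h.2
    · refine Or.inr (Subtype.ext (eq_of_subset_of_card_le ?_ (card_eq T R).le))
      intro t ht
      have hta : t ≠ a := fun h => haR (h ▸ ht)
      have := hR ht
      rw [hT] at this ⊢
      simp only [mem_union, mem_insert, mem_erase] at this ⊢
      tauto
  · intro h
    by_contra hax
    -- When `a` and `x` are far apart, `S ∪ {x}` is separated; dropping a point `z` other than `a`,
    -- `x` gives a third configuration.
    have hW : Separated s (insert x S.1) := by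
      apply S.2.2.insert _ _ hn
      · intro d h0 hd hm
        by_cases e : x + (d : ZMod n) = a
        · exact hax ⟨d, h0, by omega, Or.inr e.symm⟩
        · refine T.2.2 x hxT d h0 hd ?_
          rw [hT]
          exact mem_insert_of_mem (mem_erase.2 ⟨e, hm⟩)
      · intro d h0 hd hm
        by_cases e : x - (d : ZMod n) = a
        · exact hax ⟨d, h0, by omega, Or.inl (by rw [← e]; ring)⟩
        · refine T.2.2.sub_notMem hxT h0 hd ?_
          rw [hT]
          exact mem_insert_of_mem (mem_erase.2 ⟨e, hm⟩)
    obtain ⟨z, hz⟩ : (S.1.erase a).Nonempty := by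
      rw [← card_pos, card_erase_of_mem haS, S.2.1]; omega
    rw [mem_erase] at hz
    have hzx : z ≠ x := fun h => hxS (h ▸ hz.2)
    have := h ⟨(insert x S.1).erase z, by
      rw [card_erase_of_mem (mem_insert_of_mem hz.2), card_insert_of_notMem hxS, S.2.1]; rfl,
      hW.mono (erase_subset _ _)⟩ (by
        intro t ht
        simp only [mem_erase, mem_insert] at ht
        rw [mem_union]
        rcases ht.2 with rfl | h
        · exact Or.inr hxT
        · exact Or.inl h)
    rcases this with e | e
    · exact hxS (e ▸ mem_erase.2 ⟨hzx.symm, mem_insert_self _ _⟩)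
    · exact haT (e ▸ mem_erase.2 ⟨hz.1.symm, mem_insert_of_mem haS⟩)

section Automorphism

variable [NeZero n] (φ : separatedGraph n k s ≃g separatedGraph n k s)

theorem Slide.map (hs : 2 ≤ s) (hk : 2 ≤ k) (hn : 2 * s ≤ n) {S T : Config n k s} {a x : ZMod n}
    (h : Slide S T a x) : ∃ b y, Slide (φ S) (φ T) b y := by
  have h1 := (oneSwap_map φ hs hk hn).2 h.oneSwap
  obtain ⟨b, y, hb, hy⟩ := h1.exists_eq (card_eq _ _)
  refine ⟨b, y, hb, hy, ?_⟩
  have h2 := (near_iff_of_sdiff hk (by omega) h.1 h.2.1).1 h.2.2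
  rw [near_iff_of_sdiff hk (by omega) hb hy]
  intro R hR
  obtain ⟨R, rfl⟩ := φ.surjective R
  rw [map_subset_iff φ hs hk hn h.oneSwap] at hR
  rcases h2 R hR with rfl | rfl <;> simp

end Automorphism

/-- The configuration `a, a + s, …, a + (k - 1) s`. -/
def base (k : ℕ) (hs : 0 < s) (hn : s * k < n) (a : ZMod n) : Config n k s :=
  ⟨progression k s a, card_progression hs hn, separated_progression hn⟩

/-- Replacing `a` by a near point is a slide as soon as the result is separated. -/
theorem exists_slide {S : Config n k s} {a x : ZMod n} (ha : a ∈ S.1)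
    (hax : Near (s - 1) a x) (h : Separated s (insert x (S.1.erase a))) :
    ∃ T : Config n k s, T.1 = insert x (S.1.erase a) ∧ Slide S T a x := by
  have hx : x ∉ S.1 := by
    intro hx
    obtain ⟨d, h0, hd, rfl | rfl⟩ := hax
    · exact S.2.2 _ ha d h0 (by omega) hx
    · exact S.2.2 _ hx d h0 (by omega) ha
  exact ⟨⟨_, by rw [card_insert_erase' ha hx, S.2.1], h⟩, rfl, slide_of_eq ha hx rfl hax⟩

/-- Otherwise `a - s` would stay in `T`, at distance `s - 1` from `a - 1`. -/
theorem slide_notMem_sub {S T : Config n k s} {a : ZMod n} (hs : 2 ≤ s) (hn : s < n)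
    (h : Slide S T a (a - 1)) : a - (s : ZMod n) ∉ S.1 := by
  obtain ⟨hT, ha, -, hx, -⟩ := eq_insert_erase h.1 h.2.1
  intro hm
  have h1 : a - (s : ZMod n) ∈ T.1 := by
    rw [hT]
    refine mem_insert_of_mem (mem_erase.2 ⟨?_, hm⟩)
    intro h
    exact natCast_zmod_ne_zero (by omega) hn (by simpa using h)
  refine T.2.2.sub_notMem hx (d := s - 1) (by omega) (by omega) ?_
  rw [Nat.cast_sub (by omega)]
  simpa using h1

theorem two_mul_lt (hk : 2 ≤ k) (hn : s * k < n) : 2 * s < n := by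
  have := Nat.mul_le_mul_left s hk
  omega

/-- Supplies the hypotheses of `map_sdiff_of_triangle` for two slides of the same point. -/
theorem sdiff_swaps {S B C : Config n k s} {a x y : ZMod n} (hB : Slide S B a x)
    (hC : Slide S C a y) (hxy : x ≠ y) : OneSwap B.1 C.1 ∧ ¬ C.1 ⊆ S.1 ∪ B.1 := by
  obtain ⟨h1, h2, h3, h4, h5⟩ := eq_insert_erase hB.1 hB.2.1
  obtain ⟨g1, g2, g3, g4, g5⟩ := eq_insert_erase hC.1 hC.2.1
  constructor
  · rw [OneSwap, card_eq_one]
    refine ⟨x, ?_⟩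
    rw [h1, g1]
    ext t
    simp only [mem_sdiff, mem_insert, mem_erase, mem_singleton]
    grind
  · intro h
    have := h g4
    rw [h1] at this
    simp only [mem_union, mem_insert, mem_erase] at this
    grind

theorem ne_sub_one (hn : 2 ≤ n) (t : ZMod n) : t ≠ t - 1 := by
  intro h
  refine natCast_zmod_ne_zero (n := n) one_pos (by omega) ?_
  push_cast
  linear_combination h

/-- A map of points through which `φ` acts on slides. -/
def IsPointMap (φ : separatedGraph n k s ≃g separatedGraph n k s) (π : ZMod n → ZMod n) : Prop :=
  ∀ S T a x, Slide S T a x → Slide (φ S) (φ T) (π a) (π x)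

theorem near_sub_one (hs : 2 ≤ s) (a : ZMod n) : Near (s - 1) a (a - 1) := by
  have := near_sub_natCast (m := s - 1) (d := 1) (a := a) one_pos (by omega)
  rwa [Nat.cast_one] at this

theorem IsPointMap.leftInverse (hs : 2 ≤ s) (hk : 2 ≤ k) (hn : s * k < n) {φ : separatedGraph n k s ≃g separatedGraph n k s}
    {π π' : ZMod n → ZMod n}
    (h : IsPointMap φ π) (h' : IsPointMap φ.symm π') : Function.LeftInverse π' π := by
  intro a
  have hn2 := two_mul_lt hk hn
  obtain ⟨P, hP⟩ : ∃ P, P = base k (by omega : 0 < s) hn a := ⟨_, rfl⟩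
  have haP : a ∈ P.1 := by rw [hP]; exact self_mem_progression (by omega)
  obtain ⟨N, hN, hPN⟩ := exists_slide (S := P) haP (near_sub_one hs a)
    (P.2.2.shift_down (by omega) haP (by rw [hP]; exact sub_notMem_progression (by omega) hn))
  have h1 := (h' _ _ _ _ (h _ _ _ _ hPN)).1
  simp only [RelIso.symm_apply_apply] at h1
  rw [hPN.1, singleton_inj] at h1
  exact h1.symm

/-! ### The point map of an automorphism. -/

section Automorphism

variable [NeZero n] (φ : separatedGraph n k s ≃g separatedGraph n k s)

/-- The images of all slides from `a` to `a - 1` remove the same point and add the same point. -/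
theorem exists_map_sdiff (hs : 2 ≤ s) (hk : 2 ≤ k) (hn : s * k < n) (a : ZMod n) :
    ∃ p q, ∀ S T : Config n k s, Slide S T a (a - 1) →
      (φ S).1 \ (φ T).1 = {p} ∧ (φ T).1 \ (φ S).1 = {q} := by
  have hn2 := two_mul_lt hk hn
  obtain ⟨M, hM⟩ : ∃ M, M = base k (by omega : 0 < s) hn a := ⟨_, rfl⟩
  have haM : a ∈ M.1 := by rw [hM]; exact self_mem_progression (by omega)
  obtain ⟨M', hM', hMM⟩ := exists_slide (S := M) haM (near_sub_one hs a)
    (M.2.2.shift_down (by omega) haM (by rw [hM]; exact sub_notMem_progression (by omega) hn))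
  obtain ⟨p, q, hp, hq⟩ := ((oneSwap_map φ hs hk hn2.le).2 hMM.oneSwap).exists_eq (card_eq _ _)
  refine ⟨p, q, fun S => ?_⟩
  obtain ⟨X, hX⟩ : ∃ X, X = S.1 := ⟨_, rfl⟩
  intro T hST
  have haS : a ∈ X := by rw [hX]; exact (eq_insert_erase hST.1 hST.2.1).2.1
  have hXc : X.card = k := hX ▸ S.2.1
  have hXs : Separated s X := hX ▸ S.2.2
  revert S T hST
  have hone := ne_sub_one (n := n) (by omega)
  refine separated_induction (P := fun X => ∀ S : Config n k s, X = S.1 → ∀ T, Slide S T a (a - 1) →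
    (φ S).1 \ (φ T).1 = {p} ∧ (φ T).1 \ (φ S).1 = {q}) hs hn (by omega) a ?_ ?_ X hXc hXs haS
  · intro S hS T hST
    have e : S = M := Subtype.ext (by rw [← hS, hM]; rfl)
    have e' : T = M' := Subtype.ext (by rw [hM', (eq_insert_erase hST.1 hST.2.1).1, e])
    rw [e, e']
    exact ⟨hp, hq⟩
  · rintro X hXc hXs haX b hbX hba hb1 hX's ih S rfl T hST
    obtain ⟨hT, -, haT, ha1T, ha1S⟩ := eq_insert_erase hST.1 hST.2.1
    have has := slide_notMem_sub hs (by omega) hST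
    -- Moving `b` back in both `S` and `T` completes a 4-cycle without diagonals; the images of its
    -- opposite edges exchange the same points.
    obtain ⟨S', hS', hSS'⟩ := exists_slide hbX (near_sub_one hs b) hX's
    have haS' : a ∈ S'.1 := by rw [hS']; exact mem_insert_of_mem (mem_erase.2 ⟨hba.symm, haX⟩)
    have hbs : a - (s : ZMod n) ≠ b - 1 := by
      intro h
      refine S.2.2.sub_notMem haX (d := s - 1) (by omega) (by omega) ?_
      rw [Nat.cast_sub (by omega), Nat.cast_one]
      have : a - ((s : ZMod n) - 1) = b := by linear_combination h
      rwa [this]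
    obtain ⟨T', hT', hST'⟩ := exists_slide haS' (near_sub_one hs a)
      (S'.2.2.shift_down (by omega) haS' (by
        rw [hS', mem_insert, not_or]
        exact ⟨hbs, fun h => has (mem_of_mem_erase h)⟩))
    have hab1 : a ≠ b - 1 := fun h => hb1 (h ▸ haX)
    have hba1 : b ≠ a - 1 := fun h => ha1S (h ▸ hbX)
    have hbT : b ∈ T.1 := by rw [hT]; exact mem_insert_of_mem (mem_erase.2 ⟨hba, hbX⟩)
    have hb1T : b - 1 ∉ T.1 := by
      rw [hT, mem_insert, not_or]
      exact ⟨fun h => hba (sub_left_injective h), fun h => hb1 (mem_of_mem_erase h)⟩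
    have hTT' : T'.1 = insert (b - 1) (T.1.erase b) := by
      rw [hT', hS', hT]
      ext t
      simp only [mem_insert, mem_erase]
      grind
    have haT' : a ∉ T'.1 := by
      rw [hT']; simp [hone a]
    have hbT' : b ∉ T'.1 := by
      rw [hTT']; simp [hone b]
    have hbS' : b ∉ S'.1 := by
      rw [hS']; simp [hone b]
    have ha1S' : a - 1 ∉ S'.1 := by
      rw [hS', mem_insert, not_or]
      exact ⟨fun h => hba (sub_left_injective h).symm, fun h => ha1S (mem_of_mem_erase h)⟩
    have hTT : Slide T T' b (b - 1) := slide_of_eq hbT hb1T hTT' (near_sub_one hs b)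
    have := map_sdiff_of_square φ hs hk hn2.le hST.oneSwap hTT.oneSwap hST'.oneSwap hSS'.oneSwap
      (fun h => haT' (h ▸ haX)) (not_oneSwap_of_ne hba.symm haX haT' hbX hbT')
      (fun h => hbS' (h ▸ hbT)) (not_oneSwap_of_ne hba1 hbT hbS' ha1T ha1S')
    rw [this.1, this.2]
    exact ih S' hS'.symm T' hST'

theorem exists_isPointMap (hs : 2 ≤ s) (hk : 2 ≤ k) (hn : s * k + 2 ≤ n) :
    ∃ π, IsPointMap φ π := by
  have hn1 : s * k < n := by omega
  have hn2 := two_mul_lt hk hn1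
  choose p q hp hq using exists_map_sdiff φ hs hk hn1
  have hone := ne_sub_one (n := n) (by omega)
  -- Slide `a` to `a - 1` and on to `a - 2`, which is free since `n ≥ s k + 2`. From the middle
  -- configuration both neighbours replace `a - 1`, so the triangle argument applies.
  have hpq : ∀ a, q a = p (a - 1) := by
    intro a
    obtain ⟨P, hP⟩ : ∃ P, P = base k (by omega : 0 < s) hn1 a := ⟨_, rfl⟩
    have haP : a ∈ P.1 := by rw [hP]; exact self_mem_progression (by omega)
    obtain ⟨N, hN, hPN⟩ := exists_slide (S := P) haP (near_sub_one hs a)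
      (P.2.2.shift_down (by omega) haP (by rw [hP]; exact sub_notMem_progression (by omega) hn1))
    have haN : a - 1 ∈ N.1 := by rw [hN]; exact mem_insert_self _ _
    obtain ⟨C, hC, hNC⟩ := exists_slide haN (near_sub_one hs _)
      (N.2.2.shift_down (by omega) haN (by
        rw [hN, mem_insert, not_or]
        constructor
        · intro h
          exact natCast_zmod_ne_zero (n := n) (d := s) (by omega) (by omega) (by simpa using h)
        · intro h
          have h := mem_of_mem_erase h
          rw [hP] at h
          have hn' : (s : ℤ) * k + 2 ≤ n := by exact_mod_cast hn
          obtain ⟨j, -, hj⟩ := add_intCast_mem_progression (k := k) (s := s) (a := a)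
            (c := -(s + 1)) (by
              have e : a + ((-(s + 1) : ℤ) : ZMod n) = a - 1 - s := by push_cast; ring
              rw [e]; exact h) (by linarith) (by omega)
          have : (0 : ℤ) ≤ s * j := by positivity
          omega))
    have hne : a ≠ a - 1 - 1 := by
      intro h
      refine natCast_zmod_ne_zero (n := n) (d := 2) (by omega) (by omega) ?_
      push_cast
      linear_combination h
    obtain ⟨h1, h2⟩ := sdiff_swaps hPN.symm hNC hne
    have := map_sdiff_of_triangle φ hs hk hn2.le hPN.symm.oneSwap hNC.oneSwap h1 h2
    rw [hq _ _ _ hPN, hp _ _ _ hNC, singleton_inj] at this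
    exact this
  refine ⟨p, ?_⟩
  have hup : ∀ S T a, Slide S T a (a + 1) → (φ S).1 \ (φ T).1 = {p a} := by
    intro S T a h
    have e : a + 1 - 1 = a := by ring
    have := h.symm
    nth_rewrite 2 [← e] at this
    rw [hq _ _ _ this, hpq, e]
  -- Compare with the slide of `a` by one step in the same direction. It is legal: the point of `S`
  -- at distance `s` that could block it would remain in `T`, too close to `x`.
  have main : ∀ S T a x, Slide S T a x → (φ S).1 \ (φ T).1 = {p a} := by
    intro S T a x h
    obtain ⟨hT, ha, haT, hxT, hxS⟩ := eq_insert_erase h.1 h.2.1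
    have hsn : (s : ZMod n) ≠ 0 := natCast_zmod_ne_zero (by omega) (by omega)
    obtain ⟨d, h0, hd, hx | hx⟩ := h.2.2
    · by_cases hxa : x = a + 1
      · subst hxa; exact hup _ _ _ h
      have near : Near (s - 1) a (a + 1) := ⟨1, one_pos, by omega, Or.inl (by simp)⟩
      obtain ⟨C, -, hSC⟩ := exists_slide ha near (S.2.2.shift_up (by omega) ha (by
        intro hm
        refine T.2.2 x hxT (s - d) (by omega) (by omega) ?_
        rw [Nat.cast_sub (by omega), hx, hT]
        refine mem_insert_of_mem (mem_erase.2 ?_)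
        rw [show a + (d : ZMod n) + (s - d) = a + s by ring]
        exact ⟨by simpa using hsn, hm⟩))
      obtain ⟨h1, h2⟩ := sdiff_swaps hSC h (Ne.symm hxa)
      rw [← map_sdiff_of_triangle φ hs hk hn2.le hSC.oneSwap h.oneSwap h1 h2]
      exact hup _ _ _ hSC
    · by_cases hxa : x = a - 1
      · subst hxa; exact hp _ _ _ h
      obtain ⟨C, -, hSC⟩ := exists_slide ha (near_sub_one hs a) (S.2.2.shift_down (by omega) ha (by
        intro hm
        refine T.2.2.sub_notMem hxT (d := s - d) (by omega) (by omega) ?_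
        have hx' : x = a - d := by rw [hx]; ring
        rw [Nat.cast_sub (by omega), hx', hT]
        refine mem_insert_of_mem (mem_erase.2 ?_)
        rw [show a - (d : ZMod n) - (s - d) = a - s by ring]
        exact ⟨by simpa using hsn, hm⟩))
      obtain ⟨h1, h2⟩ := sdiff_swaps hSC h (Ne.symm hxa)
      rw [← map_sdiff_of_triangle φ hs hk hn2.le hSC.oneSwap h.oneSwap h1 h2]
      exact hp _ _ _ hSC
  intro S T a x h
  obtain ⟨b, y, hby⟩ := h.map φ hs hk hn2.le
  have h1 := main _ _ _ _ h
  have h2 := main _ _ _ _ h.symm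
  refine ⟨h1, h2, ?_⟩
  rw [hby.1, singleton_inj] at h1
  rw [hby.2.1, singleton_inj] at h2
  rw [← h1, ← h2]
  exact hby.2.2

variable {φ} in
/-- A point map of an automorphism induces it. -/
theorem IsPointMap.map_eq (hs : 2 ≤ s) (hk : 2 ≤ k) (hn : s * k < n) {π : ZMod n → ZMod n}
    (h : IsPointMap φ π) (hπ : Function.Injective π) (S : Config n k s) :
    (φ S).1 = S.1.image π := by
  have hn2 := two_mul_lt hk hn
  have key : ∀ a ∈ S.1, π a ∈ (φ S).1 := by
    intro a ha
    refine separated_induction (P := fun X => ∀ S : Config n k s, X = S.1 → π a ∈ (φ S).1) hs hn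
      (by omega) a ?_ ?_ S.1 S.2.1 S.2.2 ha S rfl
    · intro P hP
      have haP : a ∈ P.1 := by rw [← hP]; exact self_mem_progression (by omega)
      obtain ⟨N, hN, hPN⟩ := exists_slide (S := P) haP (near_sub_one hs a)
        (P.2.2.shift_down (by omega) haP (by rw [← hP]; exact sub_notMem_progression (by omega) hn))
      have := h _ _ _ _ hPN
      exact (eq_insert_erase this.1 this.2.1).2.1
    · rintro X hXc hXs haX b hbX hba hb1 hX's ih S rfl
      obtain ⟨S', hS', hSS'⟩ := exists_slide hbX (near_sub_one hs b) hX's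
      have h1 := h _ _ _ _ hSS'
      have h2 := ih S' hS'.symm
      rw [(eq_insert_erase h1.1 h1.2.1).1, mem_insert, mem_erase] at h2
      rcases h2 with h2 | h2
      · exact absurd (hπ h2 ▸ haX) hb1
      · exact h2.2
  refine (eq_of_subset_of_card_le ?_ ?_).symm
  · intro t ht
    obtain ⟨a, ha, rfl⟩ := mem_image.1 ht
    exact key a ha
  · rw [card_image_of_injective _ hπ, card_eq S (φ S)]

end Automorphism

/-- The points `a` and `x` can be exchanged in some configuration. -/
def Linked (k s : ℕ) (a x : ZMod n) : Prop := ∃ S T : Config n k s, Slide S T a x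

theorem Linked.symm {a x : ZMod n} (h : Linked k s a x) : Linked k s x a := by
  obtain ⟨S, T, h⟩ := h
  exact ⟨T, S, Slide.symm h⟩

/-- Pulling the other points back never obstructs a backward slide of `a`, so the progression from
`a` is the extreme case. There the gap behind `a` is `n - s (k - 1)` and must stay at least `s`. -/
theorem linked_iff [NeZero n] (hs : 2 ≤ s) (hk : 2 ≤ k) (hn : s * k < n) {a x : ZMod n} :
    Linked k s a x ↔ Near (min (s - 1) (n - s * k)) a x := by
  have hn2 := two_mul_lt hk hn
  have hn' : (s : ℤ) * k < n := by exact_mod_cast hn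
  constructor
  · have main : ∀ (a : ZMod n) (d : ℕ), 0 < d → d < s → Linked k s a (a - (d : ZMod n)) →
        d ≤ n - s * k := by
      rintro a d h0 hd ⟨S, T, h⟩
      obtain ⟨hT, ha, -, -, -⟩ := eq_insert_erase h.1 h.2.1
      have hTs := T.2.2
      rw [hT] at hTs
      revert hTs
      refine separated_induction (P := fun X => Separated s (insert (a - (d : ZMod n)) (X.erase a)) →
        d ≤ n - s * k) hs hn (by omega) a ?_ ?_ S.1 S.2.1 S.2.2 ha
      · intro hsep
        by_contra! hlt
        have hsk : s * (k - 1) + s = s * k := by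
          rw [← Nat.mul_succ, Nat.succ_eq_add_one, Nat.sub_add_cancel (by omega)]
        -- This `d` is the distance from the last term `a + s (k - 1)` up to `a - d`.
        refine hsep.sub_notMem (mem_insert_self _ _) (d := n - s * (k - 1) - d) (by omega)
          (by omega) (mem_insert_of_mem (mem_erase.2 ⟨?_, mem_progression.2 ⟨k - 1, by omega, ?_⟩⟩))
        · intro e
          refine natCast_zmod_ne_zero (n := n) (d := s * (k - 1)) ?_ (by omega) ?_
          · exact Nat.mul_pos (by omega) (by omega)
          · rw [Nat.cast_sub (by omega), Nat.cast_sub (by omega), ZMod.natCast_self] at e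
            linear_combination e
        · rw [Nat.cast_sub (by omega), Nat.cast_sub (by omega), ZMod.natCast_self]
          ring
      · intro X hXc hXs haX b hbX hba hb1 hX's ih hsep
        apply ih
        have hbs : b - (s : ZMod n) ∉ X := by
          intro hm
          refine hX's.sub_notMem (mem_insert_self _ _) (d := s - 1) (by omega) (by omega) ?_
          rw [Nat.cast_sub (by omega)]
          refine mem_insert_of_mem (mem_erase.2 ⟨?_, by simpa using hm⟩)
          intro e
          refine natCast_zmod_ne_zero (n := n) (d := s) (by omega) (by omega) ?_
          push_cast at e
          linear_combination -e
        have hb : b ∈ insert (a - (d : ZMod n)) (X.erase a) :=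
          mem_insert_of_mem (mem_erase.2 ⟨hba, hbX⟩)
        have := hsep.shift_down (b := b) (by omega) hb (by
          rw [mem_insert, not_or]
          refine ⟨fun e => ?_, fun h => hbs (mem_of_mem_erase h)⟩
          refine hXs a haX (s - d) (by omega) (by omega) ?_
          rw [Nat.cast_sub (by omega)]
          rwa [show a + ((s : ZMod n) - d) = b by linear_combination -e])
        convert this using 1
        have hab1 : a ≠ b - 1 := fun h => hb1 (h ▸ haX)
        have hdb : b ≠ a - d := by
          intro e
          refine hXs.sub_notMem haX h0 hd ?_
          rwa [← e]
        ext t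
        simp only [mem_insert, mem_erase]
        grind
    intro h
    have h' := h
    obtain ⟨S, T, hST⟩ := h'
    obtain ⟨d, h0, hd, hx | hx⟩ := hST.2.2
    · refine ⟨d, h0, le_min hd (main x d h0 (by omega) ?_), Or.inl hx⟩
      rw [show x - (d : ZMod n) = a by rw [hx]; ring]
      exact h.symm
    · refine ⟨d, h0, le_min hd (main a d h0 (by omega) ?_), Or.inr hx⟩
      rwa [show a - (d : ZMod n) = x by rw [hx]; ring]
  · have main : ∀ (a : ZMod n) (d : ℕ), 0 < d → d < s → d ≤ n - s * k →
        Linked k s a (a - (d : ZMod n)) := by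
      intro a d h0 hd hdn
      have hdn' : (d : ℤ) + s * k ≤ n := by
        have : d + s * k ≤ n := by omega
        exact_mod_cast this
      obtain ⟨P, hP⟩ : ∃ P, P = base k (by omega : 0 < s) hn a := ⟨_, rfl⟩
      have haP : a ∈ P.1 := by rw [hP]; exact self_mem_progression (by omega)
      obtain ⟨N, hN, hPN⟩ := exists_slide (S := P) haP (near_sub_natCast h0 (by omega)) (by
        apply P.2.2.swap _ _ (by omega)
        · intro e he0 he hm
          rw [hP] at hm
          obtain ⟨j, -, hj⟩ := add_intCast_mem_progression (k := k) (s := s) (a := a)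
            (c := e - d) (by
              have e : a + ((e - d : ℤ) : ZMod n) = a - d + e := by push_cast; ring
              rw [e]; exact hm) (by linarith) (by omega)
          have : j = 0 := by
            by_contra hj0
            have : (s : ℤ) * 1 ≤ s * j := mul_le_mul_of_nonneg_left (by omega) (by positivity)
            omega
          rw [this] at hj
          have : e = d := by push_cast at hj; omega
          rw [this]; ring
        · intro e he0 he hm
          exfalso
          rw [hP] at hm
          obtain ⟨j, -, hj⟩ := add_intCast_mem_progression (k := k) (s := s) (a := a)
            (c := -d - e) (by
              have e : a + ((-d - e : ℤ) : ZMod n) = a - d - e := by push_cast; ring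
              rw [e]; exact hm) (by linarith) (by omega)
          have : (0 : ℤ) ≤ s * j := by positivity
          omega)
      exact ⟨P, N, hPN⟩
    rintro ⟨d, h0, hd, hx | hx⟩
    · have := main x d h0 (by omega) (by omega)
      rw [show x - (d : ZMod n) = a by rw [hx]; ring] at this
      exact this.symm
    · have := main a d h0 (by omega) (by omega)
      rwa [show a - (d : ZMod n) = x by rw [hx]; ring] at this

end Config

/-! ### Symmetries of the cycle. -/

section Cycle

variable {n : ℕ}

/-- An injective self-map of a cycle preserving adjacency is a rotation or a reflection. -/
theorem eq_add_or_eq_sub [NeZero n] (hn : 3 ≤ n) {f : ZMod n → ZMod n} (hf : Function.Injective f)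
    (h : ∀ x, f (x + 1) = f x + 1 ∨ f (x + 1) = f x - 1) :
    ∃ c, (∀ x, f x = c + x) ∨ ∀ x, f x = c - x := by
  have h2 : (2 : ZMod n) ≠ 0 := by
    have := natCast_zmod_ne_zero (n := n) two_pos (by omega)
    exact_mod_cast this
  -- Injectivity forbids turning back, so the first step fixes the direction.
  have hne : ∀ x, f (x + 1 + 1) ≠ f x := by
    intro x e
    exact h2 (by linear_combination hf e)
  have lift : ∀ P : ZMod n → Prop, (∀ j : ℕ, P j) → ∀ x, P x := by
    intro P hP x
    have := hP x.val
    rwa [ZMod.natCast_zmod_val] at this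
  refine ⟨f 0, ?_⟩
  rcases h 0 with h0 | h0
  · left
    apply lift
    intro j
    suffices f j = f 0 + j ∧ f (j + 1) = f 0 + j + 1 from this.1
    induction j with
    | zero => simpa using h0
    | succ j ih =>
      push_cast
      refine ⟨by rw [ih.2]; ring, ?_⟩
      rcases h (j + 1) with h1 | h1
      · rw [h1, ih.2]; ring
      · exact absurd (by rw [h1, ih.1, ih.2]; ring) (hne j)
  · right
    apply lift
    intro j
    suffices f j = f 0 - j ∧ f (j + 1) = f 0 - j - 1 from this.1
    induction j with
    | zero => simpa using h0
    | succ j ih =>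
      push_cast
      refine ⟨by rw [ih.2]; ring, ?_⟩
      rcases h (j + 1) with h1 | h1
      · exact absurd (by rw [h1, ih.1, ih.2]; ring) (hne j)
      · rw [h1, ih.2]; ring

/-- Consecutive points of a cycle can be recognized from the relation of being near. -/
theorem consecutive_iff [NeZero n] {m : ℕ} (hm : 1 ≤ m) (hn : 2 * m + 3 ≤ n) {a b : ZMod n}
    (hab : a ≠ b) : (b = a + 1 ∨ b = a - 1) ↔
      ∀ y z, (y = a ∨ Near m a y) → ¬ (y = b ∨ Near m b y) → (z = a ∨ Near m a z) →
        ¬ (z = b ∨ Near m b z) → y = z := by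
  -- In terms of balls of radius `m`, the criterion says that the ball about `a` has at most one
  -- point outside the ball about `b`.
  have near : ∀ u v : ZMod n, (v = u ∨ Near m u v) ↔
      ∃ d : ℤ, -(m : ℤ) ≤ d ∧ d ≤ m ∧ v = u + (d : ZMod n) := by
    intro u v
    constructor
    · rintro (rfl | ⟨d, h0, hd, h | h⟩)
      · exact ⟨0, by omega, by omega, by simp⟩
      · exact ⟨d, by omega, by omega, by rw [h]; simp⟩
      · exact ⟨-d, by omega, by omega, by rw [h]; simp⟩
    · rintro ⟨d, h1, h2, h⟩
      rcases lt_trichotomy d 0 with hd | rfl | hd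
      · refine Or.inr ⟨d.natAbs, by omega, by omega, Or.inr ?_⟩
        have : ((d.natAbs : ℤ) : ZMod n) = ((-d : ℤ) : ZMod n) := by congr 1; omega
        rw [Int.cast_natCast] at this
        rw [h, this]; push_cast; ring
      · left; simpa using h
      · refine Or.inr ⟨d.natAbs, by omega, by omega, Or.inl ?_⟩
        have : ((d.natAbs : ℤ) : ZMod n) = (d : ZMod n) := by congr 1; omega
        rw [Int.cast_natCast] at this
        rw [h, this]
  simp only [near]
  constructor
  · rintro (rfl | rfl)
    · have key : ∀ y, (∃ d : ℤ, -(m : ℤ) ≤ d ∧ d ≤ m ∧ y = a + (d : ZMod n)) →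
          (¬ ∃ d : ℤ, -(m : ℤ) ≤ d ∧ d ≤ m ∧ y = a + 1 + (d : ZMod n)) → y = a - (m : ZMod n) := by
        rintro y ⟨d, h1, h2, rfl⟩ h
        by_cases hd : d = -m
        · rw [hd]; push_cast; ring
        · exact absurd ⟨d - 1, by omega, by omega, by push_cast; ring⟩ h
      intro y z h1 h2 h3 h4
      rw [key y h1 h2, key z h3 h4]
    · have key : ∀ y, (∃ d : ℤ, -(m : ℤ) ≤ d ∧ d ≤ m ∧ y = a + (d : ZMod n)) →
          (¬ ∃ d : ℤ, -(m : ℤ) ≤ d ∧ d ≤ m ∧ y = a - 1 + (d : ZMod n)) → y = a + (m : ZMod n) := by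
        rintro y ⟨d, h1, h2, rfl⟩ h
        by_cases hd : d = m
        · rw [hd]; push_cast; ring
        · exact absurd ⟨d + 1, by omega, by omega, by push_cast; ring⟩ h
      intro y z h1 h2 h3 h4
      rw [key y h1 h2, key z h3 h4]
  · intro h
    by_contra! hb
    obtain ⟨j, hj, rfl⟩ := exists_add_natCast a b
    have j0 : j ≠ 0 := by rintro rfl; simp at hab
    have j1 : j ≠ 1 := by rintro rfl; simp at hb
    have jn : j ≠ n - 1 := by
      rintro rfl
      apply hb.2
      rw [Nat.cast_sub (by omega), ZMod.natCast_self]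
      push_cast; ring
    -- `a + e` and `a + e + 1` are to be in the first ball but not the second: the lower end if the
    -- second ball does not wrap round to it, the upper end if `b` is far enough above, otherwise
    -- the two points just past the second ball.
    obtain ⟨e, he1, he2, he⟩ : ∃ e : ℤ, -(m : ℤ) ≤ e ∧ e + 1 ≤ m ∧
        ∀ d : ℤ, -(m : ℤ) ≤ d → d ≤ m → -(n : ℤ) < e - j - d ∧ e + 1 - j - d < 0 := by
      by_cases c1 : j + 2 * m < n
      · exact ⟨-m, by omega, by omega, fun d h1 h2 => by omega⟩
      · by_cases c2 : 2 * m < j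
        · exact ⟨m - 1, by omega, by omega, fun d h1 h2 => by omega⟩
        · exact ⟨j + m + 1 - n, by omega, by omega, fun d h1 h2 => by omega⟩
    have far : ∀ e' : ℤ, (e' = e ∨ e' = e + 1) → ¬ ∃ d : ℤ, -(m : ℤ) ≤ d ∧ d ≤ m ∧
        a + (e' : ZMod n) = a + (j : ZMod n) + (d : ZMod n) := by
      rintro e' he' ⟨d, h1, h2, h3⟩
      have := he d h1 h2
      have : e' - j - d = 0 := by
        apply intCast_zmod_eq_zero (n := n) _ (by omega) (by omega)
        push_cast
        linear_combination h3
      omega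
    have := h (a + (e : ZMod n)) (a + ((e + 1 : ℤ) : ZMod n)) ⟨e, he1, by omega, rfl⟩
      (far e (Or.inl rfl)) ⟨e + 1, by omega, he2, rfl⟩ (far (e + 1) (Or.inr rfl))
    refine natCast_zmod_ne_zero (n := n) one_pos (by omega) ?_
    push_cast at this ⊢
    linear_combination -this

/-- The action of the dihedral group on the points of the cycle. -/
def dihedralPerm (n : ℕ) : DihedralGroup n →* Equiv.Perm (ZMod n) where
  toFun
    | .r i => Equiv.addRight i
    | .sr i => (Equiv.addRight i).trans (Equiv.neg _)
  map_one' := by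
    rw [DihedralGroup.one_def]
    ext x
    simp
  map_mul' := by
    rintro (i | i) (j | j)
    · rw [DihedralGroup.r_mul_r]
      ext x; simp; ring
    · rw [DihedralGroup.r_mul_sr]
      ext x; simp; ring
    · rw [DihedralGroup.sr_mul_r]
      ext x; simp; ring
    · rw [DihedralGroup.sr_mul_sr]
      ext x; simp; ring

@[simp] theorem dihedralPerm_r (i x : ZMod n) : dihedralPerm n (.r i) x = x + i := rfl

@[simp] theorem dihedralPerm_sr (i x : ZMod n) : dihedralPerm n (.sr i) x = -(x + i) := rfl

theorem dihedralPerm_injective (hn : 3 ≤ n) : Function.Injective (dihedralPerm n) := by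
  rw [injective_iff_map_eq_one]
  rintro (i | i) h
  · have := Equiv.congr_fun h 0
    rw [dihedralPerm_r, Equiv.Perm.one_apply, zero_add] at this
    rw [this, DihedralGroup.one_def]
  · exfalso
    have h0 := Equiv.congr_fun h 0
    have h1 := Equiv.congr_fun h 1
    rw [dihedralPerm_sr, Equiv.Perm.one_apply] at h0 h1
    refine natCast_zmod_ne_zero (n := n) (d := 2) (by omega) (by omega) ?_
    push_cast
    linear_combination h0 - h1

theorem exists_dihedralPerm {f : ZMod n → ZMod n}
    (h : ∃ c, (∀ x, f x = c + x) ∨ ∀ x, f x = c - x) : ∃ g, f = dihedralPerm n g := by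
  obtain ⟨c, h | h⟩ := h
  · exact ⟨.r c, funext fun x => by rw [h, dihedralPerm_r, add_comm]⟩
  · exact ⟨.sr (-c), funext fun x => by rw [h, dihedralPerm_sr]; ring⟩

theorem Separated.map_dihedralPerm {s : ℕ} {S : Finset (ZMod n)} (h : Separated s S)
    (g : DihedralGroup n) : Separated s (S.map (dihedralPerm n g).toEmbedding) := by
  intro i hi d h0 hd hm
  obtain ⟨u, hu, rfl⟩ := mem_map.1 hi
  obtain ⟨v, hv, hvu⟩ := mem_map.1 hm
  rw [Equiv.coe_toEmbedding] at hvu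
  rcases g with c | c
  · simp only [dihedralPerm_r] at hvu
    refine h u hu d h0 hd ?_
    rwa [show u + (d : ZMod n) = v by linear_combination -hvu]
  · simp only [dihedralPerm_sr] at hvu
    refine h.sub_notMem hu h0 hd ?_
    rwa [show u - (d : ZMod n) = v by linear_combination hvu]

end Cycle

/-! ### The dihedral action, and the case `n ≥ s * k + 2`. -/

namespace Config

variable {n k s : ℕ}

/-- The action of the dihedral group on configurations. -/
def move (g : DihedralGroup n) (S : Config n k s) : Config n k s :=
  ⟨S.1.map (dihedralPerm n g).toEmbedding, by rw [card_map, S.2.1], S.2.2.map_dihedralPerm g⟩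

theorem move_one (S : Config n k s) : move 1 S = S :=
  Subtype.ext (by ext x; simp [move]; rfl)

theorem move_mul (g h : DihedralGroup n) (S : Config n k s) : move (g * h) S = move g (move h S) :=
  Subtype.ext (by ext x; simp [move]; rfl)

/-- The dihedral group acts on the disjointness graph of separated sets. -/
def dihedralAut (n k s : ℕ) :
    DihedralGroup n →* (separatedGraph n k s ≃g separatedGraph n k s) where
  toFun g :=
    { toFun := move g
      invFun := move g⁻¹
      left_inv := fun S => by rw [← move_mul, inv_mul_cancel, move_one]
      right_inv := fun S => by rw [← move_mul, mul_inv_cancel, move_one]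
      map_rel_iff' := by
        intro S T
        change move g S ≠ move g T ∧ Disjoint (move g S).1 (move g T).1 ↔ S ≠ T ∧ Disjoint S.1 T.1
        refine and_congr (not_congr ⟨fun h => ?_, congrArg _⟩) (Finset.disjoint_map _)
        rw [← move_one S, ← inv_mul_cancel g, move_mul, h, ← move_mul, inv_mul_cancel, move_one] }
  map_one' := by
    ext S : 1
    exact move_one S
  map_mul' g h := by
    ext S : 1
    exact move_mul g h S

theorem dihedralAut_apply (g : DihedralGroup n) (S : Config n k s) :
    (dihedralAut n k s g S).1 = S.1.map (dihedralPerm n g).toEmbedding := rfl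

/-- A trivially acting element fixes every configuration, hence every point, as each is the
difference of two configurations. -/
theorem dihedralAut_injective [NeZero n] (hs : 2 ≤ s) (hk : 2 ≤ k) (hn : s * k < n) :
    Function.Injective (dihedralAut n k s) := by
  rw [injective_iff_map_eq_one]
  intro g hg
  have hn2 := two_mul_lt hk hn
  apply dihedralPerm_injective (n := n) (by omega)
  rw [map_one]
  ext a
  obtain ⟨P, hP⟩ : ∃ P, P = base k (by omega : 0 < s) hn a := ⟨_, rfl⟩
  have haP : a ∈ P.1 := by rw [hP]; exact self_mem_progression (by omega)
  obtain ⟨N, hN, hPN⟩ := exists_slide (S := P) haP (near_sub_one hs a)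
    (P.2.2.shift_down (by omega) haP (by rw [hP]; exact sub_notMem_progression (by omega) hn))
  have hfix : ∀ S : Config n k s, ∀ x, dihedralPerm n g x ∈ S.1 ↔ x ∈ S.1 := by
    intro S x
    have h := dihedralAut_apply g S
    rw [hg] at h
    change S.1 = _ at h
    conv_lhs => rw [h]
    simp
  have h1 : dihedralPerm n g a ∈ P.1 \ N.1 := by
    rw [mem_sdiff, hfix, hfix, ← mem_sdiff, hPN.1, mem_singleton]
  rw [hPN.1, mem_singleton] at h1
  exact h1

section Automorphism

variable [NeZero n] (φ : separatedGraph n k s ≃g separatedGraph n k s)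

theorem exists_dihedral_of_large (hs : 2 ≤ s) (hk : 2 ≤ k) (hn : s * k + 2 ≤ n) :
    ∃ g, dihedralAut n k s g = φ := by
  have hn1 : s * k < n := by omega
  have hn2 := two_mul_lt hk hn1
  obtain ⟨π, hπ⟩ := exists_isPointMap φ hs hk hn
  obtain ⟨π', hπ'⟩ := exists_isPointMap φ.symm hs hk hn
  have hl : Function.LeftInverse π' π := hπ.leftInverse hs hk hn1 hπ'
  have hr : Function.RightInverse π' π := hπ'.leftInverse hs hk hn1 hπ
  have inj := hl.injective
  have near : ∀ a x, Near (min (s - 1) (n - s * k)) (π a) (π x) ↔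
      Near (min (s - 1) (n - s * k)) a x := by
    intro a x
    rw [← linked_iff hs hk hn1, ← linked_iff hs hk hn1]
    constructor
    · rintro ⟨S, T, h⟩
      have := hπ' _ _ _ _ h
      rw [hl, hl] at this
      exact ⟨_, _, this⟩
    · rintro ⟨S, T, h⟩
      exact ⟨_, _, hπ _ _ _ _ h⟩
  have step : ∀ x, π (x + 1) = π x + 1 ∨ π (x + 1) = π x - 1 := by
    intro x
    have hne : x ≠ x + 1 := by
      have := ne_sub_one (n := n) (by omega) (x + 1)
      rw [add_sub_cancel_right] at this
      exact this.symm
    rw [consecutive_iff (m := min (s - 1) (n - s * k)) (by omega) (by omega) (inj.ne hne)]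
    have := (consecutive_iff (m := min (s - 1) (n - s * k)) (by omega) (by omega) hne).1
      (Or.inl rfl)
    intro y z
    obtain ⟨y, rfl⟩ := hr.surjective y
    obtain ⟨z, rfl⟩ := hr.surjective z
    simp only [inj.eq_iff, near]
    exact this y z
  obtain ⟨g, hg⟩ := exists_dihedralPerm (eq_add_or_eq_sub (by omega) inj step)
  refine ⟨g, ?_⟩
  ext S : 1
  apply Subtype.ext
  rw [dihedralAut_apply, hπ.map_eq hs hk hn1 inj S, hg, map_eq_image]
  rfl

end Automorphism

end Config

/-! ### The tight case `n = s * k + 1`. -/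

namespace Config

variable {n k s : ℕ}

/-- The start is the only term whose predecessor at distance `s` is missing. -/
theorem base_injective (hs : 0 < s) (hn : s * k < n) (hk : 0 < k) :
    Function.Injective (base k hs hn) := by
  intro a b h
  have h : progression k s a = progression k s b := congrArg Subtype.val h
  obtain ⟨j, hj, hb⟩ := mem_progression.1 (h ▸ self_mem_progression hk : b ∈ progression k s a)
  rcases Nat.eq_zero_or_pos j with rfl | h0
  · simpa using hb.symm
  · exfalso
    apply sub_notMem_progression (a := b) hs hn
    rw [← h]
    refine mem_progression.2 ⟨j - 1, by omega, ?_⟩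
    rw [hb]
    push_cast [Nat.cast_sub (show 1 ≤ j from h0)]
    ring

section Tight

variable [NeZero n]

/-- When `n = s * k + 1`, every configuration is a progression. -/
theorem exists_eq_base (hs : 2 ≤ s) (hk : 2 ≤ k) (hn : s * k + 1 = n) (S : Config n k s) :
    ∃ a, S = base k (by omega) (by omega) a := by
  have hn1 : s * k < n := by omega
  have hn2 := two_mul_lt hk hn1
  have hcast : (s : ZMod n) * k + 1 = 0 := by
    have : ((s * k + 1 : ℕ) : ZMod n) = 0 := by rw [hn, ZMod.natCast_self]
    exact_mod_cast this
  -- Otherwise `S` is closed under subtracting `s` and contains both `c` and `c - s k = c + 1`.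
  have hex : ∃ a ∈ S.1, a - (s : ZMod n) ∉ S.1 := by
    by_contra! h
    obtain ⟨c, hc⟩ : S.1.Nonempty := by rw [← card_pos, S.2.1]; omega
    have hall : ∀ j : ℕ, c - (s : ZMod n) * j ∈ S.1 := by
      intro j
      induction j with
      | zero => simpa using hc
      | succ j ih =>
        have := h _ ih
        push_cast
        rwa [show c - (s : ZMod n) * (j + 1) = c - s * j - s by ring]
    refine S.2.2 c hc 1 one_pos (by omega) ?_
    have := hall k
    rwa [show c - (s : ZMod n) * k = c + (1 : ℕ) by push_cast; linear_combination -hcast] at this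
  obtain ⟨a, ha, has⟩ := hex
  refine ⟨a, Subtype.ext ?_⟩
  change S.1 = progression k s a
  revert has
  refine separated_induction (P := fun X => a - (s : ZMod n) ∉ X → X = progression k s a) hs hn1
    (by omega) a (fun _ => rfl) ?_ S.1 S.2.1 S.2.2 ha
  intro X hXc hXs haX b hbX hba hb1 hX's ih has
  exfalso
  have h1 := ih (by
    rw [mem_insert, not_or]
    refine ⟨fun h => ?_, fun h => has (mem_of_mem_erase h)⟩
    refine hXs.sub_notMem haX (d := s - 1) (by omega) (by omega) ?_
    rw [Nat.cast_sub (by omega), Nat.cast_one]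
    rwa [show a - ((s : ZMod n) - 1) = b by linear_combination h])
  have h2 : b - 1 ∈ progression k s a := by rw [← h1]; exact mem_insert_self _ _
  -- Here `b` is one step past a term of the progression: too close to the next term, or, past the
  -- last one, equal to `a - s`.
  obtain ⟨j, hj, hbj⟩ := mem_progression.1 h2
  push_cast at hbj
  by_cases hjk : j + 1 < k
  · have h3 : b + ((s - 1 : ℕ) : ZMod n) ∈ progression k s a := by
      refine mem_progression.2 ⟨j + 1, hjk, ?_⟩
      rw [Nat.cast_sub (by omega)]
      push_cast
      linear_combination hbj
    rw [← h1, mem_insert] at h3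
    rcases h3 with h3 | h3
    · refine natCast_zmod_ne_zero (n := n) (d := s) (by omega) (by omega) ?_
      rw [Nat.cast_sub (by omega)] at h3
      push_cast at h3
      linear_combination h3
    · exact hXs b hbX (s - 1) (by omega) (by omega) (mem_of_mem_erase h3)
  · obtain rfl : k = j + 1 := by omega
    apply has
    push_cast at hcast
    rwa [show a - (s : ZMod n) = b by linear_combination -hbj - hcast]

/-- Since `s * (-k) = 1` modulo `n`, points can be indexed by multiples of `s`. Progressions become
arcs of `k` indices, and the arcs from `0` and `i` differ in one point only for `i = ±1`. -/
theorem eq_of_oneSwap_base (hs : 2 ≤ s) (hk : 2 ≤ k) (hn : s * k + 1 = n) {a b : ZMod n}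
    (h : OneSwap (base k (by omega : 0 < s) (by omega : s * k < n) a).1
      (base k (by omega : 0 < s) (by omega : s * k < n) b).1) :
    b = a + s ∨ b = a - s := by
  change OneSwap (progression k s a) (progression k s b) at h
  have hn1 : s * k < n := by omega
  have hkn : 2 * k < n := by
    have := Nat.mul_le_mul_right k hs
    omega
  have hcast : (s : ZMod n) * k + 1 = 0 := by
    have : ((s * k + 1 : ℕ) : ZMod n) = 0 := by rw [hn, ZMod.natCast_self]
    exact_mod_cast this
  have cancel : ∀ u : ℤ, -(n : ℤ) < u → u < n → (s : ZMod n) * (u : ZMod n) = 0 → u = 0 := by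
    intro u h1 h2 h3
    refine intCast_zmod_eq_zero (n := n) ?_ h1 h2
    linear_combination (-(k : ZMod n)) * h3 + u * hcast
  obtain ⟨i, hi, hib⟩ := exists_add_natCast (0 : ZMod n) (-(k : ZMod n) * (b - a))
  have hb : b = a + s * i := by linear_combination (s : ZMod n) * hib + (b - a) * hcast
  have notMem : ∀ j : ℕ, j < k → (∀ j' : ℕ, j' < k → (j : ℤ) - i - j' ≠ 0 ∧
      -(n : ℤ) < j - i - j' + n ∧ (j : ℤ) - i - j' + n ≠ 0 ∧ (j : ℤ) - i - j' < n) →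
      a + ((s * j : ℕ) : ZMod n) ∉ progression k s b := by
    intro j hj h hm
    obtain ⟨j', hj', e⟩ := mem_progression.1 hm
    have h' := h j' hj'
    rw [hb] at e
    push_cast at e
    by_cases hlt : -(n : ℤ) < (j : ℤ) - i - j'
    · exact h'.1 (cancel _ hlt h'.2.2.2 (by push_cast; linear_combination e))
    · exact h'.2.2.1 (cancel _ h'.2.1 (by omega) (by
        push_cast; rw [ZMod.natCast_self]; linear_combination e))
  have distinct : ∀ j : ℕ, a + ((s * (j + 1) : ℕ) : ZMod n) ≠ a + ((s * j : ℕ) : ZMod n) := by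
    intro j e
    have := cancel 1 (by omega) (by omega) (by push_cast at e ⊢; linear_combination e)
    omega
  have hi0 : i ≠ 0 := by
    rintro rfl
    rw [Nat.cast_zero, mul_zero, add_zero] at hb
    rw [hb, OneSwap, sdiff_self] at h
    simp at h
  by_cases h1 : i = 1
  · left; rw [hb, h1]; simp
  by_cases h2 : i = n - 1
  · right
    rw [hb, h2, Nat.cast_sub (by omega), ZMod.natCast_self]
    push_cast; ring
  exfalso
  -- The second arc misses indices `0`, `1` if it does not wrap, and `k - 2`, `k - 1` if it does.
  by_cases hle : i ≤ n - k
  · exact not_oneSwap_of_ne (distinct 0) (mem_progression.2 ⟨1, by omega, rfl⟩)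
      (notMem 1 (by omega) fun j' hj' => by omega) (mem_progression.2 ⟨0, by omega, rfl⟩)
      (notMem 0 (by omega) fun j' hj' => by omega) h
  · exact not_oneSwap_of_ne (distinct (k - 2)) (mem_progression.2 ⟨k - 2 + 1, by omega, rfl⟩)
      (notMem (k - 2 + 1) (by omega) fun j' hj' => by omega)
      (mem_progression.2 ⟨k - 2, by omega, rfl⟩)
      (notMem (k - 2) (by omega) fun j' hj' => by omega) h

theorem oneSwap_base_add (hs : 2 ≤ s) (hk : 2 ≤ k) (hn : s * k + 1 = n) (a : ZMod n) :
    OneSwap (base k (by omega : 0 < s) (by omega : s * k < n) a).1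
      (base k (by omega : 0 < s) (by omega : s * k < n) (a + s)).1 := by
  have hn1 : s * k < n := by omega
  have hn2 := two_mul_lt hk hn1
  have ha : a ∈ (base k (by omega : 0 < s) hn1 a).1 := self_mem_progression (by omega)
  obtain ⟨N, hN, hPN⟩ := exists_slide ha (near_sub_one hs a)
    (Separated.shift_down (base k (by omega : 0 < s) hn1 a).2.2 (by omega) ha
      (sub_notMem_progression (by omega) hn1))
  obtain ⟨b, rfl⟩ := exists_eq_base hs hk hn N
  have h := hPN.oneSwap
  rcases eq_of_oneSwap_base hs hk hn h with e | e
  · rw [e] at h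
    exact h
  -- The progression from `a - s` contains `a`, which the slide removed.
  · exfalso
    apply (eq_insert_erase hPN.1 hPN.2.1).2.2.1
    exact mem_progression.2 ⟨1, by omega, by rw [e]; simp⟩

theorem exists_dihedral_of_tight (φ : separatedGraph n k s ≃g separatedGraph n k s) (hs : 2 ≤ s)
    (hk : 2 ≤ k) (hn : s * k + 1 = n) : ∃ g, dihedralAut n k s g = φ := by
  have hn1 : s * k < n := by omega
  have hn2 := two_mul_lt hk hn1
  have hs0 : 0 < s := by omega
  have hcast : (s : ZMod n) * k + 1 = 0 := by
    have : ((s * k + 1 : ℕ) : ZMod n) = 0 := by rw [hn, ZMod.natCast_self]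
    exact_mod_cast this
  choose ψ hψ using fun a => exists_eq_base hs hk hn (φ (base k hs0 hn1 a))
  have inj : Function.Injective ψ := by
    intro a b h
    apply base_injective hs0 hn1 (by omega)
    apply φ.injective
    rw [hψ, hψ, h]
  have step : ∀ a, ψ (a + s) = ψ a + s ∨ ψ (a + s) = ψ a - s := by
    intro a
    have h := (oneSwap_map φ hs hk hn2.le).2 (oneSwap_base_add hs hk hn a)
    rw [hψ, hψ] at h
    exact eq_of_oneSwap_base hs hk hn h
  -- Multiplication by `s` and its inverse `-k` turns steps of `s` into steps of `1`.
  obtain ⟨c, hc⟩ := eq_add_or_eq_sub (n := n) (f := fun i => -(k : ZMod n) * ψ (s * i)) (by omega)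
    (by
      intro i j h
      simp only at h
      have h1 : ψ (s * i) = ψ (s * j) := by
        linear_combination (s : ZMod n) * h + (ψ (s * i) - ψ (s * j)) * hcast
      have h2 := inj h1
      linear_combination (-(k : ZMod n)) * h2 + (i - j) * hcast)
    (by
      intro i
      have e : (s : ZMod n) * (i + 1) = s * i + s := by ring
      simp only [e]
      rcases step (s * i) with h | h
      · left; rw [h]; linear_combination -hcast
      · right; rw [h]; linear_combination hcast)
  have hx : ∀ x : ZMod n, (s : ZMod n) * (-(k : ZMod n) * x) = x := fun x => by
    linear_combination (-x) * hcast
  have hψ' : (∀ x, ψ x = s * c + x) ∨ ∀ x, ψ x = s * c - x := by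
    rcases hc with hc | hc
    · left
      intro x
      have := hc (-(k : ZMod n) * x)
      simp only [hx] at this
      linear_combination (s : ZMod n) * this - hx (ψ x) + hx x
    · right
      intro x
      have := hc (-(k : ZMod n) * x)
      simp only [hx] at this
      linear_combination (s : ZMod n) * this - hx (ψ x) - hx x
  have fin : ∀ g, (∀ x, ∀ y ∈ progression k s x, dihedralPerm n g y ∈ progression k s (ψ x)) →
      dihedralAut n k s g = φ := by
    intro g hg
    ext S : 1
    obtain ⟨x, rfl⟩ := exists_eq_base hs hk hn S
    rw [hψ]
    apply Subtype.ext
    refine eq_of_subset_of_card_le ?_ (card_eq _ _).le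
    intro t ht
    obtain ⟨y, hy, rfl⟩ := mem_map.1 ht
    exact hg x y hy
  rcases hψ' with h | h
  · refine ⟨.r (s * c), fin _ fun x y hy => ?_⟩
    obtain ⟨j, hj, rfl⟩ := mem_progression.1 hy
    exact mem_progression.2 ⟨j, hj, by rw [h, dihedralPerm_r]; ring⟩
  -- A reflection reverses progressions; the offset `s (k - 1)` sends the first term to the last.
  · refine ⟨.sr (-(s * c) - s * (k - 1)), fin _ fun x y hy => ?_⟩
    obtain ⟨j, hj, rfl⟩ := mem_progression.1 hy
    refine mem_progression.2 ⟨k - 1 - j, by omega, ?_⟩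
    rw [h, dihedralPerm_sr]
    push_cast [Nat.cast_sub (show j ≤ k - 1 by omega), Nat.cast_sub (show 1 ≤ k by omega)]
    ring

end Tight

end Config

/-! ### Passage from `Fin n` to `ZMod n`. -/

section Transport

theorem separated_iff_val {n s : ℕ} [NeZero n] (hs : s ≤ n) (S : Finset (ZMod n)) :
    (∀ i ∈ S, ∀ j ∈ S, i ≠ j → (s : ℤ) ≤ |(i.val : ℤ) - (j.val : ℤ)| ∧
      |(i.val : ℤ) - (j.val : ℤ)| ≤ (n : ℤ) - (s : ℤ)) ↔ Separated s S := by
  constructor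
  · intro h i hi d h0 hd hm
    have hne : i ≠ i + (d : ZMod n) := fun e =>
      natCast_zmod_ne_zero (n := n) h0 (by omega) (left_eq_add.1 e)
    have h1 := h i hi _ hm hne
    have hv : (i + (d : ZMod n)).val = (i.val + d) % n := by
      rw [ZMod.val_add, ZMod.val_cast_of_lt (by omega : d < n)]
    have hlt : i.val < n := ZMod.val_lt i
    rcases abs_cases ((i.val : ℤ) - ((i + (d : ZMod n)).val : ℤ)) with h2 | h2 <;>
      by_cases hc : i.val + d < n
    all_goals first
      | rw [Nat.mod_eq_of_lt hc] at hv
        omega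
      | rw [Nat.mod_eq_sub_mod (by omega), Nat.mod_eq_of_lt (by omega)] at hv
        omega
  · intro h
    have main : ∀ i ∈ S, ∀ j ∈ S, i.val < j.val → s ≤ j.val - i.val ∧ j.val - i.val + s ≤ n := by
      intro i hi j hj hij
      have hjlt : j.val < n := ZMod.val_lt j
      constructor
      · by_contra! hlt
        refine h i hi _ (by omega) hlt ?_
        rw [Nat.cast_sub hij.le, ZMod.natCast_zmod_val, ZMod.natCast_zmod_val]
        rwa [add_sub_cancel]
      · by_contra! hlt
        refine h j hj (n - (j.val - i.val)) (by omega) (by omega) ?_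
        rw [Nat.cast_sub (by omega), Nat.cast_sub hij.le, ZMod.natCast_zmod_val,
          ZMod.natCast_zmod_val, ZMod.natCast_self]
        rwa [show j + (0 - (j - i)) = i by ring]
    intro i hi j hj hij
    rcases abs_cases ((i.val : ℤ) - (j.val : ℤ)) with h2 | h2 <;>
      rcases lt_or_gt_of_ne (fun h => hij (ZMod.val_injective n h) : i.val ≠ j.val) with hlt | hlt
    all_goals first
      | have := main i hi j hj hlt
        omega
      | have := main j hj i hi hlt
        omega

variable {m s : ℕ}

theorem isStableSet_iff_separated (hs : s ≤ m + 1) (S : Finset (Fin (m + 1))) :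
    IsStableSet s S ↔ Separated (n := m + 1) s S :=
  separated_iff_val (n := m + 1) hs S

/-- The stable Kneser graph as the disjointness graph of separated sets of residues. -/
def stableKneserGraphIso (k : ℕ) (hs : s ≤ m + 1) :
    stableKneserGraph (m + 1) k s ≃g separatedGraph (m + 1) k s where
  toFun S := ⟨S.1.1, S.1.2, (isStableSet_iff_separated hs _).1 S.2⟩
  invFun S := ⟨⟨S.1, S.2.1⟩, (isStableSet_iff_separated hs _).2 S.2.2⟩
  left_inv _ := rfl
  right_inv _ := rfl
  map_rel_iff' := by
    intro S T
    change (_ ≠ _ ∧ Disjoint S.1.1 T.1.1) ↔ (S.1 ≠ T.1 ∧ Disjoint S.1.1 T.1.1)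
    refine and_congr_left fun _ => not_congr ?_
    rw [Subtype.ext_iff (a1 := S.1)]
    exact Subtype.ext_iff

/-- Isomorphic graphs have isomorphic automorphism groups. -/
def autCongr {V W : Type*} {G : SimpleGraph V} {H : SimpleGraph W} (e : G ≃g H) :
    (G ≃g G) ≃* (H ≃g H) where
  toFun f := e.symm.trans (f.trans e)
  invFun f := e.trans (f.trans e.symm)
  left_inv f := by ext x; simp
  right_inv f := by ext x; simp
  map_mul' f g := by ext x; simp

end Transport

theorem theorem3p4 (n s k : ℕ) (hs : 2 ≤ s) (hk : 2 ≤ k) (hn : s * k + 1 ≤ n) :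
    Nonempty ((stableKneserGraph n k s ≃g stableKneserGraph n k s) ≃* DihedralGroup n) := by
  -- For a successor, `ZMod (m + 1)` is `Fin (m + 1)` by definition.
  obtain ⟨m, rfl⟩ : ∃ m, n = m + 1 := ⟨n - 1, by omega⟩
  have hn2 := Config.two_mul_lt hk hn
  refine ⟨(autCongr (stableKneserGraphIso k (by omega))).trans (MulEquiv.ofBijective
    (Config.dihedralAut (m + 1) k s) ⟨Config.dihedralAut_injective hs hk hn, fun φ => ?_⟩).symm⟩
  rcases lt_or_eq_of_le hn with h | h
  · exact Config.exists_dihedral_of_large φ hs hk h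
  · exact Config.exists_dihedral_of_tight φ hs hk h
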